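/- Let $M$ be a connected smooth manifold of dimension $n\ge 3$ with a smooth (positive definite) Riemannian metric $g$, Levi-Civita connection $\nabla$, Ricci tensor $\mathsf{Ri}$, scalar curvature $\mathsf{sc}=g^{ij}\mathsf{Ri}_{ij}$ and $|\mathsf{Ri}|^2=g^{ia}g^{jb}\mathsf{Ri}_{ij}\mathsf{Ri}_{ab}$. Assume that $\mathsf{Ri}$ is not identically zero and that it is pseudo Ricci symmetric with associated one-form $\alpha$, that is, $\alpha$ is a smooth one-form on $M$, not identically zero, such that in all local coordinates $$\mathsf{Ri}_{ij;\ell}=2\alpha_\ell\,\mathsf{Ri}_{ij}+\alpha_i\,\mathsf{Ri}_{\ell j}+\alpha_j\,\mathsf{Ri}_{i\ell}.$$ Then $\mathsf{Ri}\,\alpha=0$ (that is, $\mathsf{Ri}_{ij}\,g^{jk}\alpha_k=0$), $|\mathsf{Ri}|^2$ is positive everywhere on $M$, and $$\alpha=\tfrac14\,\nabla\ln(|\mathsf{Ri}|^2).$$ If in addition $\mathsf{sc}$ is not identically zero, then $\mathsf{sc}$ vanishes nowhere, $$\alpha=\tfrac12\,\nabla\ln|\mathsf{sc}|\qquad\text{and}\qquad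 \mathsf{sc}^2=c\,|\mathsf{Ri}|^2$$ for some constant $c\in\mathbb{R}$. (Here $\nabla f=df$ for a function $f$.) -/

import Mathlib

open scoped Manifold ContDiff Bundle

noncomputable section

namespace RiemGeom

variable {n : ℕ} {M : Type*} [TopologicalSpace M] [ChartedSpace (EuclideanSpace ℝ (Fin n)) M]
  [IsManifold (𝓡 n) ∞ M]

/-- A smooth Riemannian metric on the `n`-dimensional manifold `M`: a smooth section of symmetric
positive definite bilinear forms on the tangent spaces. -/
abbrev Metric (n : ℕ) (M : Type*) [TopologicalSpace M]
    [ChartedSpace (EuclideanSpace ℝ (Fin n)) M] [IsManifold (𝓡 n) ∞ M] :=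
  Bundle.ContMDiffRiemannianMetric (IB := 𝓡 n) (n := ∞) (F := EuclideanSpace ℝ (Fin n))
    (E := fun p : M => TangentSpace (𝓡 n) p)

/-- A smooth one-form on `M`: a smooth section of the cotangent bundle. -/
abbrev OneForm (n : ℕ) (M : Type*) [TopologicalSpace M]
    [ChartedSpace (EuclideanSpace ℝ (Fin n)) M] [IsManifold (𝓡 n) ∞ M] :=
  ContMDiffSection (𝓡 n) (EuclideanSpace ℝ (Fin n) →L[ℝ] ℝ) ∞
    (fun p : M => TangentSpace (𝓡 n) p →L[ℝ] Bundle.Trivial M ℝ p)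

/-- Local charts of `M` with values in `ℝⁿ`. -/
abbrev Chart (n : ℕ) (M : Type*) [TopologicalSpace M] :=
  OpenPartialHomeomorph M (EuclideanSpace ℝ (Fin n))

/-- The smooth charts of `M`. -/
def smoothCharts (n : ℕ) (M : Type*) [TopologicalSpace M]
    [ChartedSpace (EuclideanSpace ℝ (Fin n)) M] : Set (Chart n M) :=
  IsManifold.maximalAtlas (𝓡 n) ∞ M

/-- The partial derivative `∂ᵢ f` of a function on `ℝⁿ`. -/
def pd (i : Fin n) (f : EuclideanSpace ℝ (Fin n) → ℝ) (y : EuclideanSpace ℝ (Fin n)) : ℝ :=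
  fderiv ℝ f y (EuclideanSpace.single i 1)

/-- The coordinate vector `∂ᵢ` of the chart `e`, at the point with coordinates `y`. -/
def coordVec (e : Chart n M) (y : EuclideanSpace ℝ (Fin n)) (i : Fin n) :
    TangentSpace (𝓡 n) (e.symm y) :=
  mfderiv (𝓡 n) (𝓡 n) e.symm y (EuclideanSpace.single i (1 : ℝ) : EuclideanSpace ℝ (Fin n))

/-- The components `αᵢ` of a one-form in the chart `e`. -/
def formCoeff (α : OneForm n M) (e : Chart n M) (y : EuclideanSpace ℝ (Fin n)) (i : Fin n) : ℝ :=
  α (e.symm y) (coordVec e y i)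

/-- The matrix `(gᵢⱼ)` of the metric in the chart `e`. -/
def gLow (g : Metric n M) (e : Chart n M) (y : EuclideanSpace ℝ (Fin n)) :
    Matrix (Fin n) (Fin n) ℝ :=
  Matrix.of fun i j => g.inner (e.symm y) (coordVec e y i) (coordVec e y j)

/-- The inverse matrix `(gⁱʲ)`. -/
def gUp (g : Metric n M) (e : Chart n M) (y : EuclideanSpace ℝ (Fin n)) :
    Matrix (Fin n) (Fin n) ℝ :=
  (gLow g e y)⁻¹

/-- The Christoffel symbols of the Levi-Civita connection: `christoffel g e k i j y` is
`Γᵏᵢⱼ = ½ gᵏˡ (∂ᵢ gⱼₗ + ∂ⱼ gᵢₗ - ∂ₗ gᵢⱼ)`. -/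
def christoffel (g : Metric n M) (e : Chart n M) (k i j : Fin n)
    (y : EuclideanSpace ℝ (Fin n)) : ℝ :=
  (1 / 2 : ℝ) * ∑ l, gUp g e y k l *
    (pd i (fun z => gLow g e z j l) y + pd j (fun z => gLow g e z i l) y
      - pd l (fun z => gLow g e z i j) y)

/-- The curvature tensor: `riemann g e l i j k y` is the component `Rˡᵢⱼₖ`, where
`R(∂ᵢ, ∂ⱼ)∂ₖ = ∇ᵢ∇ⱼ∂ₖ - ∇ⱼ∇ᵢ∂ₖ = ∑ₗ Rˡᵢⱼₖ ∂ₗ`. -/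
def riemann (g : Metric n M) (e : Chart n M) (l i j k : Fin n)
    (y : EuclideanSpace ℝ (Fin n)) : ℝ :=
  pd i (christoffel g e l j k) y - pd j (christoffel g e l i k) y
    + ∑ m, (christoffel g e l i m y * christoffel g e m j k y
      - christoffel g e l j m y * christoffel g e m i k y)

/-- The components `Riⱼₖ = ∑ᵢ Rⁱᵢⱼₖ` of the Ricci tensor. -/
def ricci (g : Metric n M) (e : Chart n M) (j k : Fin n) (y : EuclideanSpace ℝ (Fin n)) : ℝ :=
  ∑ i, riemann g e i i j k y

/-- The components `Riᵢⱼ;ₗ` of the covariant derivative of the Ricci tensor. -/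
def covRicci (g : Metric n M) (e : Chart n M) (i j l : Fin n)
    (y : EuclideanSpace ℝ (Fin n)) : ℝ :=
  pd l (ricci g e i j) y
    - ∑ m, (christoffel g e m l i y * ricci g e m j y + christoffel g e m l j y * ricci g e i m y)

/-- The scalar curvature `sc = gⁱʲ Riᵢⱼ`, as a function on `M`. -/
def scalarCurv (g : Metric n M) (p : M) : ℝ :=
  let e : Chart n M := chartAt (EuclideanSpace ℝ (Fin n)) p
  ∑ i, ∑ j, gUp g e (e p) i j * ricci g e i j (e p)

/-- The squared pointwise norm `|Ri|² = gⁱᵃ gʲᵇ Riᵢⱼ Riₐᵦ`, as a function on `M`. -/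
def ricciNormSq (g : Metric n M) (p : M) : ℝ :=
  let e : Chart n M := chartAt (EuclideanSpace ℝ (Fin n)) p
  ∑ i, ∑ j, ∑ a, ∑ b,
    gUp g e (e p) i a * gUp g e (e p) j b * ricci g e i j (e p) * ricci g e a b (e p)

/-- The Ricci tensor is not identically zero. -/
def RicciNonzero (g : Metric n M) : Prop :=
  ∃ e ∈ smoothCharts n M, ∃ y ∈ e.target, ∃ i j, ricci g e i j y ≠ 0

/-- The Ricci tensor of `g` is pseudo Ricci symmetric with associated one-form `α`: the one-form
is not identically zero and `Riᵢⱼ;ₗ = 2 αₗ Riᵢⱼ + αᵢ Riₗⱼ + αⱼ Riᵢₗ` in all smooth charts. -/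
structure IsPRS (g : Metric n M) (α : OneForm n M) : Prop where
  nonzero : ∃ p, α p ≠ 0
  eqn : ∀ e ∈ smoothCharts n M, ∀ y ∈ e.target, ∀ i j l,
    covRicci g e i j l y = 2 * formCoeff α e y l * ricci g e i j y
      + formCoeff α e y i * ricci g e l j y + formCoeff α e y j * ricci g e i l y

/-- `Ri α = 0`, that is `∑ⱼₖ Riᵢⱼ gʲᵏ αₖ = 0` in all smooth charts. -/
def RicciAnnihilates (g : Metric n M) (α : OneForm n M) : Prop :=
  ∀ e ∈ smoothCharts n M, ∀ y ∈ e.target, ∀ i,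
    ∑ j, ∑ k, ricci g e i j y * gUp g e y j k * formCoeff α e y k = 0

/-- The differential `∇f = df` of a function, as a covector at `p`. -/
def differential (f : M → ℝ) (p : M) : TangentSpace (𝓡 n) p →L[ℝ] ℝ :=
  mfderiv (𝓡 n) 𝓘(ℝ, ℝ) f p

/-- `f` is differentiable on `M`, and `α = c ∇f`. -/
def IsMulDifferential (α : OneForm n M) (c : ℝ) (f : M → ℝ) : Prop :=
  MDifferentiable (𝓡 n) 𝓘(ℝ, ℝ) f ∧
    ∀ (p : M) (v : TangentSpace (𝓡 n) p), α p v = c * differential f p v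

end RiemGeom

end

namespace RiemGeom

/-! The defining equation is contracted with the metric in two ways. Tracing over the two Ricci
indices gives d sc = 2 sc α + 2 Ri α. Contracting a Ricci index with the derivative index and using
the contracted second Bianchi identity, d sc = 2 div Ri, gives d sc = 2 sc α + 6 Ri α. Comparison
forces Ri α = 0, hence d sc = 2 sc α. Contracting with Ri itself then leaves d|Ri|² = 4 |Ri|² α.
This is `pseudoRicciSymmetric_eqns`, resting on `contracted_bianchi`.

What remains is the equation df = c f α on a connected manifold, `IsExpSolution`. Along a segment in
a chart it is a linear homogeneous ODE, so the zero set of a solution is open as well as closed, and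
a solution with one zero vanishes identically (`IsExpSolution.eq_zero`). Hence |Ri|² and, if not
identically zero, sc have no zeros, and dividing by f gives the logarithmic formulas. Both sc² and
|Ri|² solve the equation with c = 4; a linear combination of them vanishing at one point vanishes
everywhere, so they are proportional.

The geometry is done with matrices in a single chart. Since `scalarCurv` and `ricciNormSq` use the
preferred chart at each point, they must be shown to be independent of the chart before they can be
differentiated; this is the purpose of the pullback results. -/

/-- The coordinate space `ℝⁿ`. -/
abbrev Coord (n : ℕ) := EuclideanSpace ℝ (Fin n)

variable {n : ℕ}

/-! ### Partial derivatives on ℝⁿ. -/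

section PartialDerivatives

variable {U : Set (Coord n)} {y : Coord n} {f h : Coord n → ℝ} {i : Fin n}

lemma pd_add (hf : DifferentiableAt ℝ f y) (hh : DifferentiableAt ℝ h y) :
    pd i (fun z => f z + h z) y = pd i f y + pd i h y := by
  simp [pd, fderiv_fun_add hf hh]

lemma pd_sub (hf : DifferentiableAt ℝ f y) (hh : DifferentiableAt ℝ h y) :
    pd i (fun z => f z - h z) y = pd i f y - pd i h y := by
  simp [pd, fderiv_fun_sub hf hh]

lemma pd_mul (hf : DifferentiableAt ℝ f y) (hh : DifferentiableAt ℝ h y) :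
    pd i (fun z => f z * h z) y = pd i f y * h y + f y * pd i h y := by
  simp [pd, fderiv_fun_mul hf hh]; ring

lemma pd_sum {ι : Type*} {s : Finset ι} {F : ι → Coord n → ℝ}
    (hF : ∀ a ∈ s, DifferentiableAt ℝ (F a) y) :
    pd i (fun z => ∑ a ∈ s, F a z) y = ∑ a ∈ s, pd i (F a) y := by
  simp [pd, fderiv_fun_sum hF]

lemma pd_const (c : ℝ) : pd i (fun _ => c) y = 0 := by
  simp [pd]

lemma pd_congr (hU : IsOpen U) (hy : y ∈ U) (hfh : Set.EqOn f h U) : pd i f y = pd i h y := by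
  unfold pd
  rw [(hfh.eventuallyEq_of_mem (hU.mem_nhds hy)).fderiv_eq]

lemma contDiffOn_pd (hU : IsOpen U) (hf : ContDiffOn ℝ ∞ f U) : ContDiffOn ℝ ∞ (pd i f) U :=
  (hf.fderiv_of_isOpen hU (by simp)).clm_apply contDiffOn_const

lemma pd_comm (hU : IsOpen U) (hf : ContDiffOn ℝ ∞ f U) (hy : y ∈ U) (i j : Fin n) :
    pd i (pd j f) y = pd j (pd i f) y := by
  have hc : ContDiffAt ℝ ∞ f y := hf.contDiffAt (hU.mem_nhds hy)
  have hs : IsSymmSndFDerivAt ℝ f y := hc.isSymmSndFDerivAt (by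
    rw [minSmoothness_of_isRCLikeNormedField]
    exact WithTop.coe_le_coe.2 le_top)
  have hd : DifferentiableAt ℝ (fderiv ℝ f) y :=
    (hc.fderiv_right (m := ∞) (by simp)).differentiableAt (by simp)
  have key : ∀ a b : Fin n, pd a (pd b f) y
      = fderiv ℝ (fderiv ℝ f) y (EuclideanSpace.single a 1) (EuclideanSpace.single b 1) := by
    intro a b
    unfold pd
    rw [fderiv_clm_apply hd (by fun_prop)]
    simp
  rw [key, key]
  exact hs.eq _ _

lemma fderiv_eq_sum_pd (v : Coord n) : fderiv ℝ f y v = ∑ a, v a * pd a f y := by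
  have hv : v = ∑ a, v a • EuclideanSpace.single a (1 : ℝ) := by
    ext b
    simp [Pi.single_apply]
  conv_lhs => rw [hv]
  simp [pd]

lemma pd_comp {φ : Coord n → Coord n} (hf : DifferentiableAt ℝ f (φ y))
    (hφ : DifferentiableAt ℝ φ y) :
    pd i (fun z => f (φ z)) y = ∑ a, pd i (fun z => φ z a) y * pd a f (φ y) := by
  have h1 : fderiv ℝ (fun z => f (φ z)) y = (fderiv ℝ f (φ y)).comp (fderiv ℝ φ y) :=
    fderiv_comp y hf hφ
  have h2 : ∀ a, pd i (fun z => φ z a) y = fderiv ℝ φ y (EuclideanSpace.single i 1) a := by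
    intro a
    have := (((EuclideanSpace.proj (𝕜 := ℝ) a).hasFDerivAt (x := φ y)).comp y hφ.hasFDerivAt).fderiv
    unfold pd
    exact congrArg (fun L : Coord n →L[ℝ] ℝ => L (EuclideanSpace.single i 1)) this
  conv_lhs => unfold pd
  rw [h1, ContinuousLinearMap.comp_apply, fderiv_eq_sum_pd]
  simp [h2]

end PartialDerivatives

/-! ### Calculus of matrix-valued functions. -/

section MatrixCalculus

variable {U : Set (Coord n)} {y : Coord n} {F H : Coord n → Matrix (Fin n) (Fin n) ℝ}

/-- The entrywise partial derivative of a matrix-valued function. -/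
noncomputable def mpd (i : Fin n) (F : Coord n → Matrix (Fin n) (Fin n) ℝ) (y : Coord n) :
    Matrix (Fin n) (Fin n) ℝ :=
  Matrix.of fun a b => pd i (fun z => F z a b) y

/-- Smoothness of a matrix-valued function on a set. -/
def SmoothMat (F : Coord n → Matrix (Fin n) (Fin n) ℝ) (U : Set (Coord n)) : Prop :=
  ∀ a b, ContDiffOn ℝ ∞ (fun z => F z a b) U

/-- Differentiability of a matrix-valued function at a point. -/
def DiffMat (F : Coord n → Matrix (Fin n) (Fin n) ℝ) (y : Coord n) : Prop :=
  ∀ a b, DifferentiableAt ℝ (fun z => F z a b) y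

lemma _root_.ContDiffOn.differentiableAt_of_isOpen {f : Coord n → ℝ} (hf : ContDiffOn ℝ ∞ f U)
    (hU : IsOpen U) (hy : y ∈ U) : DifferentiableAt ℝ f y :=
  (hf.contDiffAt (hU.mem_nhds hy)).differentiableAt (by simp)

lemma SmoothMat.diffMat (hF : SmoothMat F U) (hU : IsOpen U) (hy : y ∈ U) : DiffMat F y :=
  fun a b => (hF a b).differentiableAt_of_isOpen hU hy

lemma SmoothMat.mul (hF : SmoothMat F U) (hH : SmoothMat H U) :
    SmoothMat (fun z => F z * H z) U := by
  intro a b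
  simp only [Matrix.mul_apply]
  exact ContDiffOn.sum fun c _ => (hF a c).mul (hH c b)

lemma SmoothMat.add (hF : SmoothMat F U) (hH : SmoothMat H U) :
    SmoothMat (fun z => F z + H z) U :=
  fun a b => (hF a b).add (hH a b)

lemma SmoothMat.sub (hF : SmoothMat F U) (hH : SmoothMat H U) :
    SmoothMat (fun z => F z - H z) U :=
  fun a b => (hF a b).sub (hH a b)

lemma SmoothMat.sum {ι : Type*} {s : Finset ι} {F : ι → Coord n → Matrix (Fin n) (Fin n) ℝ}
    (hF : ∀ c ∈ s, SmoothMat (F c) U) : SmoothMat (fun z => ∑ c ∈ s, F c z) U := by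
  intro a b
  simp only [Matrix.sum_apply]
  exact ContDiffOn.sum fun c hc => hF c hc a b

lemma SmoothMat.smul {f : Coord n → ℝ} (hf : ContDiffOn ℝ ∞ f U) (hF : SmoothMat F U) :
    SmoothMat (fun z => f z • F z) U :=
  fun a b => hf.mul (hF a b)

lemma SmoothMat.transpose (hF : SmoothMat F U) : SmoothMat (fun z => (F z).transpose) U :=
  fun a b => hF b a

lemma SmoothMat.mpd (hU : IsOpen U) (hF : SmoothMat F U) (i : Fin n) : SmoothMat (mpd i F) U :=
  fun a b => contDiffOn_pd hU (hF a b)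

lemma SmoothMat.det (hF : SmoothMat F U) : ContDiffOn ℝ ∞ (fun z => (F z).det) U := by
  simp only [Matrix.det_apply]
  exact ContDiffOn.sum fun σ _ => (contDiffOn_prod fun c _ => hF _ _).const_smul _

lemma SmoothMat.trace (hF : SmoothMat F U) : ContDiffOn ℝ ∞ (fun z => (F z).trace) U := by
  simp only [Matrix.trace, Matrix.diag_apply]
  exact ContDiffOn.sum fun c _ => hF c c

lemma SmoothMat.inv (hF : SmoothMat F U) (hdet : ∀ z ∈ U, (F z).det ≠ 0) :
    SmoothMat (fun z => (F z)⁻¹) U := by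
  intro a b
  have h : ∀ z, (F z)⁻¹ a b = ((F z).det)⁻¹ * (F z).adjugate a b := by
    intro z
    rw [Matrix.inv_def, Ring.inverse_eq_inv']
    rfl
  simp only [h, Matrix.adjugate_apply]
  refine (hF.det.inv hdet).mul (SmoothMat.det fun c d => ?_)
  by_cases hc : c = b
  · subst hc
    simp only [Matrix.updateRow_self]
    exact contDiffOn_const
  · simp only [Matrix.updateRow_ne hc]
    exact hF c d

lemma mpd_mul (hF : DiffMat F y) (hH : DiffMat H y) (i : Fin n) :
    mpd i (fun z => F z * H z) y = mpd i F y * H y + F y * mpd i H y := by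
  ext a b
  simp only [mpd, Matrix.of_apply, Matrix.mul_apply, Matrix.add_apply]
  rw [pd_sum (F := fun c z => F z a c * H z c b) fun c _ => (hF a c).mul (hH c b),
    ← Finset.sum_add_distrib]
  exact Finset.sum_congr rfl fun c _ => pd_mul (hF a c) (hH c b)

lemma mpd_add (hF : DiffMat F y) (hH : DiffMat H y) (i : Fin n) :
    mpd i (fun z => F z + H z) y = mpd i F y + mpd i H y := by
  ext a b
  exact pd_add (hF a b) (hH a b)

lemma mpd_sub (hF : DiffMat F y) (hH : DiffMat H y) (i : Fin n) :
    mpd i (fun z => F z - H z) y = mpd i F y - mpd i H y := by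
  ext a b
  exact pd_sub (hF a b) (hH a b)

lemma mpd_neg (i : Fin n) : mpd i (fun z => -F z) y = -mpd i F y := by
  ext a b
  simp [mpd, pd, fderiv_fun_neg]

lemma mpd_smul {f : Coord n → ℝ} (hf : DifferentiableAt ℝ f y) (hF : DiffMat F y) (i : Fin n) :
    mpd i (fun z => f z • F z) y = pd i f y • F y + f y • mpd i F y := by
  ext a b
  exact pd_mul hf (hF a b)

lemma mpd_sum {ι : Type*} {s : Finset ι} {F : ι → Coord n → Matrix (Fin n) (Fin n) ℝ}
    (hF : ∀ c ∈ s, DiffMat (F c) y) (i : Fin n) :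
    mpd i (fun z => ∑ c ∈ s, F c z) y = ∑ c ∈ s, mpd i (F c) y := by
  ext a b
  simp only [mpd, Matrix.of_apply, Matrix.sum_apply]
  exact pd_sum fun c hc => hF c hc a b

lemma mpd_transpose (i : Fin n) :
    mpd i (fun z => (F z).transpose) y = (mpd i F y).transpose := rfl

lemma mpd_const (C : Matrix (Fin n) (Fin n) ℝ) (i : Fin n) : mpd i (fun _ => C) y = 0 := by
  ext a b
  exact pd_const _

lemma mpd_congr (hU : IsOpen U) (hy : y ∈ U) (hFH : Set.EqOn F H U) (i : Fin n) :
    mpd i F y = mpd i H y := by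
  ext a b
  exact pd_congr hU hy fun z hz => by simp only [hFH hz]

lemma mpd_comm (hU : IsOpen U) (hF : SmoothMat F U) (hy : y ∈ U) (i j : Fin n) :
    mpd i (mpd j F) y = mpd j (mpd i F) y := by
  ext a b
  exact pd_comm hU (hF a b) hy i j

lemma mpd_comp {φ : Coord n → Coord n} (hF : DiffMat F (φ y)) (hφ : DifferentiableAt ℝ φ y)
    (i : Fin n) :
    mpd i (fun z => F (φ z)) y = ∑ a, pd i (fun z => φ z a) y • mpd a F (φ y) := by
  ext b c
  simp only [mpd, Matrix.of_apply, Matrix.sum_apply, Matrix.smul_apply, smul_eq_mul]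
  exact pd_comp (hF b c) hφ

lemma trace_mpd (hF : DiffMat F y) (i : Fin n) :
    (mpd i F y).trace = pd i (fun z => (F z).trace) y := by
  simp only [Matrix.trace, Matrix.diag_apply, mpd, Matrix.of_apply]
  exact (pd_sum fun c _ => hF c c).symm

end MatrixCalculus

/-! ### Levi-Civita connection, curvature and Bianchi identities in one chart. -/

section LocalGeometry

open Matrix

variable {U : Set (Coord n)} {y : Coord n} {G : Coord n → Matrix (Fin n) (Fin n) ℝ}

/-- `G` is a smooth field of positive definite symmetric matrices on the open set `U`. -/
structure IsLocalMetric (G : Coord n → Matrix (Fin n) (Fin n) ℝ) (U : Set (Coord n)) : Prop where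
  isOpen : IsOpen U
  smooth : SmoothMat G U
  -- Required off `U` too, so that the entry functions `G · a b` and `G · b a` are equal and can be
  -- rewritten under `pd`.
  symm : ∀ y a b, G y a b = G y b a
  posDef : ∀ y ∈ U, (G y).PosDef

/-- The matrix `(Γᵏᵢⱼ)ₖⱼ` of Christoffel symbols of `G`. -/
noncomputable def chr (G : Coord n → Matrix (Fin n) (Fin n) ℝ) (i : Fin n) (y : Coord n) :
    Matrix (Fin n) (Fin n) ℝ :=
  Matrix.of fun k j => (1 / 2 : ℝ) * ∑ l, (G y)⁻¹ k l *
    (pd i (fun z => G z j l) y + pd j (fun z => G z i l) y - pd l (fun z => G z i j) y)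

/-- The curvature endomorphism `R(∂ᵢ, ∂ⱼ)` of `G`. -/
noncomputable def curv (G : Coord n → Matrix (Fin n) (Fin n) ℝ) (i j : Fin n) (y : Coord n) :
    Matrix (Fin n) (Fin n) ℝ :=
  mpd i (chr G j) y - mpd j (chr G i) y + (chr G i y * chr G j y - chr G j y * chr G i y)

/-- The Ricci matrix of `G`. -/
noncomputable def ric (G : Coord n → Matrix (Fin n) (Fin n) ℝ) (y : Coord n) :
    Matrix (Fin n) (Fin n) ℝ :=
  Matrix.of fun j k => ∑ i, curv G i j y i k

/-- The Ricci endomorphism of `G`. -/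
noncomputable def ricUp (G : Coord n → Matrix (Fin n) (Fin n) ℝ) (y : Coord n) :
    Matrix (Fin n) (Fin n) ℝ :=
  ric G y * (G y)⁻¹

/-- The covariant derivative of the Ricci matrix in the direction `∂ₗ`. -/
noncomputable def covRic (G : Coord n → Matrix (Fin n) (Fin n) ℝ) (l : Fin n) (y : Coord n) :
    Matrix (Fin n) (Fin n) ℝ :=
  mpd l (ric G) y - (chr G l y)ᵀ * ric G y - ric G y * chr G l y

/-- The scalar curvature of `G`. -/
noncomputable def scal (G : Coord n → Matrix (Fin n) (Fin n) ℝ) (y : Coord n) : ℝ :=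
  (ricUp G y).trace

/-- The squared norm of the Ricci tensor of `G`. -/
noncomputable def ricSq (G : Coord n → Matrix (Fin n) (Fin n) ℝ) (y : Coord n) : ℝ :=
  (ricUp G y * ricUp G y).trace

namespace IsLocalMetric

variable (hG : IsLocalMetric G U)
include hG

lemma transpose_eq (y : Coord n) : (G y)ᵀ = G y := by
  ext a b
  exact hG.symm y b a

lemma det_ne_zero (hy : y ∈ U) : (G y).det ≠ 0 := (hG.posDef y hy).det_pos.ne'

lemma mul_inv (hy : y ∈ U) : G y * (G y)⁻¹ = 1 :=
  Matrix.mul_nonsing_inv _ (isUnit_iff_ne_zero.2 (hG.det_ne_zero hy))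

lemma inv_mul (hy : y ∈ U) : (G y)⁻¹ * G y = 1 :=
  Matrix.nonsing_inv_mul _ (isUnit_iff_ne_zero.2 (hG.det_ne_zero hy))

lemma inv_transpose (y : Coord n) : ((G y)⁻¹)ᵀ = (G y)⁻¹ := by
  rw [Matrix.transpose_nonsing_inv, hG.transpose_eq]

lemma smooth_inv : SmoothMat (fun z => (G z)⁻¹) U :=
  hG.smooth.inv fun _ hz => hG.det_ne_zero hz

lemma smooth_chr (i : Fin n) : SmoothMat (chr G i) U := by
  intro k j
  refine contDiffOn_const.mul (ContDiffOn.sum fun l _ => (hG.smooth_inv k l).mul ?_)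
  exact ((contDiffOn_pd hG.isOpen (hG.smooth j l)).add
    (contDiffOn_pd hG.isOpen (hG.smooth i l))).sub (contDiffOn_pd hG.isOpen (hG.smooth i j))

lemma smooth_curv (i j : Fin n) : SmoothMat (curv G i j) U :=
  (((hG.smooth_chr j).mpd hG.isOpen i).sub ((hG.smooth_chr i).mpd hG.isOpen j)).add
    (((hG.smooth_chr i).mul (hG.smooth_chr j)).sub ((hG.smooth_chr j).mul (hG.smooth_chr i)))

lemma smooth_ric : SmoothMat (ric G) U := by
  intro j k
  simp only [ric, Matrix.of_apply]
  exact ContDiffOn.sum fun i _ => hG.smooth_curv i j i k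

lemma smooth_ricUp : SmoothMat (ricUp G) U := hG.smooth_ric.mul hG.smooth_inv

lemma chr_symm (i j k : Fin n) (y : Coord n) : chr G i y k j = chr G j y k i := by
  have h : (fun z => G z i j) = fun z => G z j i := funext fun z => hG.symm z i j
  simp only [chr, Matrix.of_apply, h]
  congr 1
  exact Finset.sum_congr rfl fun l _ => by ring

lemma mul_chr_apply (hy : y ∈ U) (i j l : Fin n) :
    (G y * chr G i y) l j = (1 / 2 : ℝ) *
      (pd i (fun z => G z j l) y + pd j (fun z => G z i l) y - pd l (fun z => G z i j) y) := by
  have h : (fun k => chr G i y k j) = (G y)⁻¹ *ᵥ (fun l => (1 / 2 : ℝ) *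
      (pd i (fun z => G z j l) y + pd j (fun z => G z i l) y - pd l (fun z => G z i j) y)) := by
    ext k
    simp only [chr, Matrix.of_apply, Matrix.mulVec, dotProduct, Finset.mul_sum]
    exact Finset.sum_congr rfl fun l _ => by ring
  have h2 : (G y * chr G i y) l j = (G y *ᵥ (fun k => chr G i y k j)) l := rfl
  rw [h2, h, Matrix.mulVec_mulVec, hG.mul_inv hy, Matrix.one_mulVec]

/-- Metric compatibility ∇g = 0 in matrix form. -/
lemma mpd_eq (hy : y ∈ U) (i : Fin n) :
    mpd i G y = (chr G i y)ᵀ * G y + G y * chr G i y := by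
  have h : ∀ a b, (fun z => G z a b) = fun z => G z b a := fun a b => funext fun z => hG.symm z a b
  have ht : (chr G i y)ᵀ * G y = (G y * chr G i y)ᵀ := by
    rw [Matrix.transpose_mul, hG.transpose_eq]
  ext a b
  rw [ht, Matrix.add_apply, Matrix.transpose_apply, hG.mul_chr_apply hy, hG.mul_chr_apply hy,
    h b a, h i b, h i a]
  simp only [mpd, Matrix.of_apply]
  ring

lemma mpd_inv (hy : y ∈ U) (i : Fin n) :
    mpd i (fun z => (G z)⁻¹) y = -(chr G i y * (G y)⁻¹) - (G y)⁻¹ * (chr G i y)ᵀ := by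
  have h1 : mpd i (fun z => G z * (G z)⁻¹) y = 0 := by
    rw [mpd_congr hG.isOpen hy (H := fun _ => 1) fun z hz => hG.mul_inv hz, mpd_const]
  rw [mpd_mul (hG.smooth.diffMat hG.isOpen hy) (hG.smooth_inv.diffMat hG.isOpen hy),
    hG.mpd_eq hy] at h1
  have h2 := congrArg (fun X => (G y)⁻¹ * X) h1
  simp only [Matrix.mul_add, Matrix.add_mul, Matrix.mul_zero, ← Matrix.mul_assoc,
    hG.inv_mul hy, Matrix.one_mul] at h2
  rw [Matrix.mul_assoc ((G y)⁻¹ * _), hG.mul_inv hy, Matrix.mul_one] at h2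
  rw [← sub_eq_zero, ← h2]
  abel

/-- Second partial derivatives of the metric commute. Expanding both orders by ∇g = 0, their
difference is exactly the left-hand side. -/
lemma curv_skew (hy : y ∈ U) (i j : Fin n) :
    (curv G i j y)ᵀ * G y + G y * curv G i j y = 0 := by
  have hd : ∀ i j : Fin n, mpd i (mpd j G) y
      = (mpd i (chr G j) y)ᵀ * G y + (chr G j y)ᵀ * ((chr G i y)ᵀ * G y + G y * chr G i y)
        + (((chr G i y)ᵀ * G y + G y * chr G i y) * chr G j y + G y * mpd i (chr G j) y) := by
    intro i j
    have hs := hG.smooth.diffMat hG.isOpen hy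
    have hc := (hG.smooth_chr j).diffMat hG.isOpen hy
    have hct := (hG.smooth_chr j).transpose.diffMat hG.isOpen hy
    have h1 := ((hG.smooth_chr j).transpose.mul hG.smooth).diffMat hG.isOpen hy
    have h2 := (hG.smooth.mul (hG.smooth_chr j)).diffMat hG.isOpen hy
    rw [mpd_congr hG.isOpen hy fun z hz => hG.mpd_eq hz j, mpd_add h1 h2, mpd_mul hct hs,
      mpd_mul hs hc, hG.mpd_eq hy, mpd_transpose]
  have h := mpd_comm hG.isOpen hG.smooth hy i j
  rw [hd, hd, ← sub_eq_zero] at h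
  rw [← h]
  simp only [curv, Matrix.transpose_add, Matrix.transpose_sub, Matrix.transpose_mul]
  noncomm_ring

/-- The first Bianchi identity: all terms cancel because the connection is torsion-free. -/
lemma curv_bianchi (y : Coord n) (i j k l : Fin n) :
    curv G i j y l k + curv G j k y l i + curv G k i y l j = 0 := by
  have h : ∀ a b, (fun z => chr G a z l b) = fun z => chr G b z l a :=
    fun a b => funext fun z => hG.chr_symm a b l z
  have h2 : ∀ a b c, (chr G a y * chr G b y) l c = (chr G a y * chr G c y) l b := by
    intro a b c
    simp only [Matrix.mul_apply]
    exact Finset.sum_congr rfl fun m _ => by rw [hG.chr_symm b c]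
  simp only [curv, Matrix.add_apply, Matrix.sub_apply, mpd, Matrix.of_apply]
  rw [h j k, h i k, h j i, h2 i j k, h2 j i k, h2 k i j]
  ring

omit hG in
lemma _root_.RiemGeom.curv_antisymm (i j : Fin n) (y : Coord n) :
    curv G i j y = -curv G j i y := by
  simp only [curv]
  abel

lemma trace_curv (hy : y ∈ U) (i j : Fin n) : (curv G i j y).trace = 0 := by
  have h := congrArg (fun X => (X * (G y)⁻¹).trace) (hG.curv_skew hy i j)
  simp only [Matrix.add_mul, Matrix.trace_add, Matrix.zero_mul, Matrix.trace_zero] at h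
  rw [Matrix.mul_assoc, hG.mul_inv hy, Matrix.mul_one, Matrix.trace_transpose,
    Matrix.trace_mul_cycle, hG.inv_mul hy, Matrix.one_mul] at h
  linarith

/-- Trace of the first Bianchi identity, the middle term dropping out because curvature
endomorphisms are trace-free. -/
lemma ric_symm (hy : y ∈ U) (j k : Fin n) : ric G y j k = ric G y k j := by
  have h : ∑ i, (curv G i j y i k + curv G j k y i i + curv G k i y i j) = 0 :=
    Finset.sum_eq_zero fun i _ => hG.curv_bianchi y i j k i
  have ht : ∑ i, curv G j k y i i = 0 := hG.trace_curv hy j k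
  have ha : ∀ i, curv G k i y i j = -curv G i k y i j := fun i => by
    rw [curv_antisymm k i y, Matrix.neg_apply]
  simp only [Finset.sum_add_distrib, ht, ha, Finset.sum_neg_distrib] at h
  simp only [ric, Matrix.of_apply]
  linarith

lemma ric_transpose (hy : y ∈ U) : (ric G y)ᵀ = ric G y := by
  ext a b
  exact hG.ric_symm hy b a

lemma mpd_curv (hy : y ∈ U) (w i j : Fin n) :
    mpd w (curv G i j) y = mpd w (mpd i (chr G j)) y - mpd w (mpd j (chr G i)) y
      + (mpd w (chr G i) y * chr G j y + chr G i y * mpd w (chr G j) y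
        - (mpd w (chr G j) y * chr G i y + chr G j y * mpd w (chr G i) y)) := by
  have hU := hG.isOpen
  have hi := hG.smooth_chr i
  have hj := hG.smooth_chr j
  have e : curv G i j = fun z => mpd i (chr G j) z - mpd j (chr G i) z
      + (chr G i z * chr G j z - chr G j z * chr G i z) := rfl
  rw [e, mpd_add (((hj.mpd hU i).sub (hi.mpd hU j)).diffMat hU hy)
    (((hi.mul hj).sub (hj.mul hi)).diffMat hU hy),
    mpd_sub ((hj.mpd hU i).diffMat hU hy) ((hi.mpd hU j).diffMat hU hy),
    mpd_sub ((hi.mul hj).diffMat hU hy) ((hj.mul hi).diffMat hU hy),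
    mpd_mul (hi.diffMat hU hy) (hj.diffMat hU hy), mpd_mul (hj.diffMat hU hy) (hi.diffMat hU hy)]

/-- The second Bianchi identity, written for the curvature as an endomorphism-valued 2-form.
Christoffel terms for the form indices `w`, `i`, `j` are omitted, as they cancel in the cyclic sum.
-/
lemma differential_bianchi (hy : y ∈ U) (w i j : Fin n) :
    (mpd w (curv G i j) y + (chr G w y * curv G i j y - curv G i j y * chr G w y))
    + (mpd i (curv G j w) y + (chr G i y * curv G j w y - curv G j w y * chr G i y))
    + (mpd j (curv G w i) y + (chr G j y * curv G w i y - curv G w i y * chr G j y)) = 0 := by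
  rw [hG.mpd_curv hy, hG.mpd_curv hy, hG.mpd_curv hy,
    mpd_comm hG.isOpen (hG.smooth_chr j) hy w i, mpd_comm hG.isOpen (hG.smooth_chr i) hy w j,
    mpd_comm hG.isOpen (hG.smooth_chr w) hy i j]
  simp only [curv]
  noncomm_ring

/-- The curvature with its last index raised is skew-symmetric. -/
lemma curvUp_skew (hy : y ∈ U) (i j : Fin n) :
    (curv G i j y * (G y)⁻¹)ᵀ = -(curv G i j y * (G y)⁻¹) := by
  have h := congrArg (fun X => (G y)⁻¹ * X * (G y)⁻¹) (hG.curv_skew hy i j)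
  simp only [Matrix.mul_add, Matrix.add_mul, Matrix.mul_zero, Matrix.zero_mul] at h
  rw [← Matrix.mul_assoc, ← Matrix.mul_assoc, hG.inv_mul hy, Matrix.one_mul,
    Matrix.mul_assoc _ (G y), hG.mul_inv hy, Matrix.mul_one] at h
  rw [Matrix.transpose_mul, hG.inv_transpose]
  exact eq_neg_of_add_eq_zero_left h

/-- Raising an index commutes with ∇, since the inverse metric is parallel. The Christoffel terms
form a commutator, so they disappear from the traces below. -/
lemma covRic_mul_inv (hy : y ∈ U) (l : Fin n) :
    covRic G l y * (G y)⁻¹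
      = mpd l (ricUp G) y + ricUp G y * (chr G l y)ᵀ - (chr G l y)ᵀ * ricUp G y := by
  have e : ricUp G = fun z => ric G z * (G z)⁻¹ := rfl
  rw [e, mpd_mul (hG.smooth_ric.diffMat hG.isOpen hy) (hG.smooth_inv.diffMat hG.isOpen hy),
    hG.mpd_inv hy]
  simp only [covRic]
  noncomm_ring

lemma trace_covRic (hy : y ∈ U) (l : Fin n) :
    (covRic G l y * (G y)⁻¹).trace = pd l (scal G) y := by
  rw [hG.covRic_mul_inv hy, Matrix.trace_sub, Matrix.trace_add,
    trace_mpd (hG.smooth_ricUp.diffMat hG.isOpen hy), Matrix.trace_mul_comm (ricUp G y)]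
  simp only [add_sub_cancel_right]
  rfl

lemma pd_ricSq (hy : y ∈ U) (l : Fin n) :
    pd l (ricSq G) y = 2 * (covRic G l y * (G y)⁻¹ * ricUp G y).trace := by
  have hd := hG.smooth_ricUp.diffMat hG.isOpen hy
  have h : pd l (ricSq G) y = 2 * (mpd l (ricUp G) y * ricUp G y).trace := by
    have := trace_mpd ((hG.smooth_ricUp.mul hG.smooth_ricUp).diffMat hG.isOpen hy) l
    rw [mpd_mul hd hd, Matrix.trace_add, Matrix.trace_mul_comm (ricUp G y)] at this
    unfold ricSq
    rw [← this]
    ring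
  rw [h, hG.covRic_mul_inv hy, Matrix.sub_mul, Matrix.add_mul, Matrix.trace_sub, Matrix.trace_add,
    Matrix.mul_assoc (ricUp G y), Matrix.trace_mul_comm (ricUp G y)]
  ring

/-- The contracted second Bianchi identity. -/
lemma contracted_bianchi (hy : y ∈ U) (w : Fin n) :
    pd w (scal G) y = 2 * ∑ x, (covRic G x y * (G y)⁻¹) w x := by
  have hU := hG.isOpen
  set S : Fin n → Fin n → Coord n → Matrix (Fin n) (Fin n) ℝ :=
    fun i j z => curv G i j z * (G z)⁻¹ with hS
  have hSd : ∀ i j, DiffMat (S i j) y := fun i j =>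
    ((hG.smooth_curv i j).mul hG.smooth_inv).diffMat hU hy
  have hS1 : ∀ i j z, S i j z = -S j i z := fun i j z => by
    simp only [hS]
    rw [curv_antisymm i j, Matrix.neg_mul]
  have hS2 : ∀ i j, ∀ z ∈ U, ∀ a b, S i j z a b = -S i j z b a := fun i j z hz a b =>
    congrFun (congrFun (hG.curvUp_skew hz i j) b) a
  have hQ1 : ∀ z a j, ∑ i, S i j z i a = ricUp G z j a := by
    intro z a j
    simp only [hS, ricUp, ric, Matrix.mul_apply, Matrix.of_apply, Finset.sum_mul]
    exact Finset.sum_comm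
  have hQ2 : ∀ z ∈ U, ∀ a i, ∑ j, S i j z a j = ricUp G z i a := by
    intro z hz a i
    rw [← hQ1]
    exact Finset.sum_congr rfl fun j _ => by
      rw [hS2 i j z hz, hS1 i j, Matrix.neg_apply, neg_neg]
  -- `T w i j` differentiates `S i j` covariantly in its two matrix indices only. It is therefore
  -- not a tensor, and the contractions `hL` and `hC` keep a Christoffel term for the index `w`,
  -- which cancels at the end.
  set T : Fin n → Fin n → Fin n → Matrix (Fin n) (Fin n) ℝ := fun w i j =>
    mpd w (S i j) y + chr G w y * S i j y + S i j y * (chr G w y)ᵀ with hT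
  have hTeq : ∀ w i j, T w i j = (mpd w (curv G i j) y
      + (chr G w y * curv G i j y - curv G i j y * chr G w y)) * (G y)⁻¹ := by
    intro w i j
    simp only [hT, hS]
    rw [mpd_mul ((hG.smooth_curv i j).diffMat hU hy) (hG.smooth_inv.diffMat hU hy), hG.mpd_inv hy]
    noncomm_ring
  have hcyc : ∀ w i j, T w i j + T i j w + T j w i = 0 := by
    intro w i j
    rw [hTeq, hTeq, hTeq, ← Matrix.add_mul, ← Matrix.add_mul, hG.differential_bianchi hy,
      Matrix.zero_mul]
  have hT1 : ∀ w i j, T w i j = -T w j i := by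
    intro w i j
    rw [hTeq, hTeq, ← Matrix.neg_mul]
    have e : mpd w (curv G i j) y = -mpd w (curv G j i) y := by
      rw [← mpd_neg]
      exact congrArg (fun F => mpd w F y) (funext fun z => curv_antisymm i j z)
    rw [e, curv_antisymm i j]
    noncomm_ring
  have hT2 : ∀ w i j a b, T w i j a b = -T w i j b a := by
    intro w i j
    have h : (T w i j)ᵀ = -T w i j := by
      have e1 : (S i j y)ᵀ = -S i j y := hG.curvUp_skew hy i j
      have e2 : (mpd w (S i j) y)ᵀ = -mpd w (S i j) y := by
        rw [← mpd_transpose, mpd_congr hU hy (H := fun z => -S i j z) fun z hz =>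
          hG.curvUp_skew hz i j, mpd_neg]
      simp only [hT, Matrix.transpose_add, Matrix.transpose_mul, Matrix.transpose_transpose, e1, e2]
      noncomm_ring
    intro a b
    exact congrFun (congrFun h b) a
  -- Double contraction of the cyclic identity; skewness in both index pairs makes its last two
  -- terms equal.
  have key : ∑ i, ∑ j, T w i j i j = -2 * ∑ i, ∑ j, T i j w i j := by
    have h0 : ∑ i, ∑ j, (T w i j + T i j w + T j w i) i j = 0 :=
      Finset.sum_eq_zero fun i _ => Finset.sum_eq_zero fun j _ => by rw [hcyc]; rfl
    simp only [Matrix.add_apply, Finset.sum_add_distrib] at h0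
    have h1 : ∑ i, ∑ j, T j w i i j = ∑ i, ∑ j, T i j w i j := by
      rw [Finset.sum_comm]
      refine Finset.sum_congr rfl fun i _ => Finset.sum_congr rfl fun j _ => ?_
      rw [hT2, hT1 i w j, Matrix.neg_apply, neg_neg]
    linarith
  have hL : ∑ i, ∑ j, T w i j i j = pd w (scal G) y
      + 2 * ∑ i, ∑ m, chr G w y i m * ricUp G y i m := by
    have h1 : ∑ i, ∑ j, mpd w (S i j) y i j = pd w (scal G) y := by
      have e : scal G = fun z => ∑ j, ∑ i, S i j z i j := by
        funext z
        simp only [hQ1]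
        rfl
      rw [e, pd_sum fun j _ => DifferentiableAt.fun_sum fun i _ => hSd i j i j, Finset.sum_comm]
      refine Finset.sum_congr rfl fun j _ => ?_
      rw [pd_sum fun i _ => hSd i j i j]
      rfl
    have h2 : ∑ i, ∑ j, (chr G w y * S i j y) i j = ∑ i, ∑ m, chr G w y i m * ricUp G y i m := by
      refine Finset.sum_congr rfl fun i _ => ?_
      simp only [Matrix.mul_apply]
      rw [Finset.sum_comm]
      refine Finset.sum_congr rfl fun m _ => ?_
      rw [← Finset.mul_sum, hQ2 y hy]
    have h3 : ∑ i, ∑ j, (S i j y * (chr G w y)ᵀ) i j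
        = ∑ i, ∑ m, chr G w y i m * ricUp G y i m := by
      rw [Finset.sum_comm]
      refine Finset.sum_congr rfl fun j _ => ?_
      simp only [Matrix.mul_apply, Matrix.transpose_apply]
      rw [Finset.sum_comm]
      refine Finset.sum_congr rfl fun m _ => ?_
      rw [← Finset.sum_mul, hQ1, mul_comm]
    simp only [hT, Matrix.add_apply, Finset.sum_add_distrib, h1, h2, h3]
    ring
  have hR : ∑ i, ∑ j, T i j w i j = -∑ i, mpd i (ricUp G) y w i
      - ∑ i, (ricUp G y * (chr G i y)ᵀ) w i := by
    have hQ3 : ∀ z ∈ U, ∀ a, ∑ j, S j w z a j = -ricUp G z w a := by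
      intro z hz a
      rw [← hQ2 z hz, ← Finset.sum_neg_distrib]
      exact Finset.sum_congr rfl fun j _ => by rw [hS1 j w, Matrix.neg_apply]
    have h1 : ∑ i, ∑ j, mpd i (S j w) y i j = -∑ i, mpd i (ricUp G) y w i := by
      rw [← Finset.sum_neg_distrib]
      refine Finset.sum_congr rfl fun i _ => ?_
      have e : ∑ j, mpd i (S j w) y i j = pd i (fun z => ∑ j, S j w z i j) y :=
        (pd_sum fun j _ => hSd j w i j).symm
      rw [e, pd_congr hU hy (h := fun z => 0 - ricUp G z w i) fun z hz => by
        simp only [hQ3 z hz, zero_sub],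
        pd_sub (differentiableAt_const _) (hG.smooth_ricUp.diffMat hU hy w i), pd_const, zero_sub]
      rfl
    have h2 : ∑ i, ∑ j, (chr G i y * S j w y) i j = -∑ i, (ricUp G y * (chr G i y)ᵀ) w i := by
      rw [← Finset.sum_neg_distrib]
      refine Finset.sum_congr rfl fun i _ => ?_
      simp only [Matrix.mul_apply, Matrix.transpose_apply]
      rw [Finset.sum_comm, ← Finset.sum_neg_distrib]
      refine Finset.sum_congr rfl fun m _ => ?_
      rw [← Finset.mul_sum, hQ3 y hy]
      ring
    -- A skew pair of indices is contracted with the symmetric lower pair of the Christoffel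
    -- symbols.
    have h3 : ∑ i, ∑ j, (S j w y * (chr G i y)ᵀ) i j = 0 := by
      rw [Finset.sum_comm]
      refine Finset.sum_eq_zero fun j _ => ?_
      simp only [Matrix.mul_apply, Matrix.transpose_apply]
      have : ∑ i, ∑ m, S j w y i m * chr G i y j m = -∑ i, ∑ m, S j w y i m * chr G i y j m := by
        conv_lhs => rw [Finset.sum_comm]
        rw [← Finset.sum_neg_distrib]
        refine Finset.sum_congr rfl fun i _ => ?_
        rw [← Finset.sum_neg_distrib]
        refine Finset.sum_congr rfl fun m _ => ?_
        rw [hS2 j w y hy m i, hG.chr_symm m i]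
        ring
      linarith
    simp only [hT, Matrix.add_apply, Finset.sum_add_distrib, h1, h2, h3]
    ring
  have hC : ∑ x, (covRic G x y * (G y)⁻¹) w x = ∑ i, mpd i (ricUp G) y w i
      + ∑ i, (ricUp G y * (chr G i y)ᵀ) w i - ∑ i, ∑ m, chr G w y i m * ricUp G y i m := by
    have h1 : ∑ i, ((chr G i y)ᵀ * ricUp G y) w i = ∑ i, ∑ m, chr G w y i m * ricUp G y i m := by
      simp only [Matrix.mul_apply, Matrix.transpose_apply]
      rw [Finset.sum_comm]
      exact Finset.sum_congr rfl fun i _ => Finset.sum_congr rfl fun m _ => by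
        rw [hG.chr_symm m w]
    simp only [hG.covRic_mul_inv hy, Matrix.sub_apply, Matrix.add_apply, Finset.sum_add_distrib,
      Finset.sum_sub_distrib, h1]
  rw [hC]
  rw [hL, hR] at key
  linarith

end IsLocalMetric

end LocalGeometry

/-! ### Contractions of the pseudo Ricci symmetry equation. -/

section PseudoRicciSymmetric

open Matrix

variable {U : Set (Coord n)} {y : Coord n} {G : Coord n → Matrix (Fin n) (Fin n) ℝ}

namespace IsLocalMetric

variable (hG : IsLocalMetric G U) {a : Fin n → ℝ}
include hG

lemma pseudoRicciSymmetric_eqns (hy : y ∈ U)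
    (h : ∀ i j l, covRic G l y i j
      = 2 * a l * ric G y i j + a i * ric G y l j + a j * ric G y i l) :
    ricUp G y *ᵥ a = 0 ∧ (∀ l, pd l (scal G) y = 2 * a l * scal G y) ∧
      ∀ l, pd l (ricSq G) y = 4 * a l * ricSq G y := by
  have hM : ∀ l, covRic G l y = (2 * a l) • ric G y + vecMulVec a (ric G y l)
      + vecMulVec (ric G y l) a := by
    intro l
    ext i j
    simp only [h, Matrix.add_apply, Matrix.smul_apply, smul_eq_mul, vecMulVec_apply]
    rw [hG.ric_symm hy i l]
    ring
  have hdot : ∀ l (v : Fin n → ℝ), ric G y l ⬝ᵥ ((G y)⁻¹ *ᵥ v) = (ricUp G y *ᵥ v) l := by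
    intro l v
    rw [ricUp, ← mulVec_mulVec]
    rfl
  -- Used with `W` the inverse metric, for sc, and with `W` the Ricci tensor with both indices
  -- raised, for |Ri|².
  have htr : ∀ l (W : Matrix (Fin n) (Fin n) ℝ), Wᵀ = W → (covRic G l y * W).trace
      = 2 * a l * (ric G y * W).trace + 2 * (ric G y l ⬝ᵥ (W *ᵥ a)) := by
    intro l W hW
    have h1 : a ᵥ* W = W *ᵥ a := by
      conv_lhs => rw [← hW]
      exact vecMul_transpose _ _
    rw [hM, Matrix.add_mul, Matrix.add_mul, Matrix.smul_mul, trace_add, trace_add, trace_smul,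
      vecMulVec_mul, vecMulVec_mul, trace_vecMulVec, trace_vecMulVec, h1, smul_eq_mul,
      dotProduct_comm a, ← dotProduct_mulVec]
    ring
  have hs1 : ∀ l, pd l (scal G) y = 2 * a l * scal G y + 2 * (ricUp G y *ᵥ a) l := by
    intro l
    rw [← hG.trace_covRic hy, htr l _ (hG.inv_transpose y), hdot]
    rfl
  have hs2 : ∀ w, pd w (scal G) y = 2 * (3 * (ricUp G y *ᵥ a) w + a w * scal G y) := by
    intro w
    have e : ∀ x, (covRic G x y * (G y)⁻¹) w x = 2 * (a x * ricUp G y w x)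
        + a w * ricUp G y x x + ric G y w x * ((G y)⁻¹ *ᵥ a) x := by
      intro x
      have e1 : (G y)⁻¹ *ᵥ a = a ᵥ* (G y)⁻¹ := by
        conv_lhs => rw [← hG.inv_transpose y]
        exact mulVec_transpose _ _
      rw [e1]
      simp only [ricUp, Matrix.mul_apply, h, vecMul, dotProduct, Finset.mul_sum,
        ← Finset.sum_add_distrib]
      exact Finset.sum_congr rfl fun z _ => by ring
    have e2 : ∑ x, ric G y w x * ((G y)⁻¹ *ᵥ a) x = (ricUp G y *ᵥ a) w := hdot w a
    have e3 : ∑ x, a x * ricUp G y w x = (ricUp G y *ᵥ a) w :=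
      Finset.sum_congr rfl fun x _ => mul_comm _ _
    have e4 : ∑ x, ricUp G y x x = scal G y := rfl
    rw [hG.contracted_bianchi hy]
    simp only [e, Finset.sum_add_distrib, ← Finset.mul_sum, e2, e3, e4]
    ring
  -- The two formulas for d sc have coefficients 2 and 6 in front of Ri α.
  have h0 : ricUp G y *ᵥ a = 0 := by
    ext l
    have := (hs1 l).symm.trans (hs2 l)
    simp only [Pi.zero_apply]
    linarith
  refine ⟨h0, fun l => by rw [hs1, h0]; simp, fun l => ?_⟩
  have hW : ((G y)⁻¹ * ricUp G y)ᵀ = (G y)⁻¹ * ricUp G y := by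
    simp only [ricUp, transpose_mul, hG.inv_transpose, hG.ric_transpose hy, Matrix.mul_assoc]
  rw [hG.pd_ricSq hy, Matrix.mul_assoc, htr l _ hW, ← mulVec_mulVec, h0]
  simp only [mulVec_zero, dotProduct_zero, ricSq]
  rw [← Matrix.mul_assoc]
  simp only [ricUp]
  ring

end IsLocalMetric

/-- Factoring the inverse metric as `Bᵀ * B` turns |Ri|² into the sum of squares of the entries of
`B * ric G y * Bᵀ`, with `B` invertible. -/
lemma ricSq_nonneg_and_ric_eq_zero (hG : IsLocalMetric G U) (hy : y ∈ U) :
    0 ≤ ricSq G y ∧ (ricSq G y = 0 → ric G y = 0) := by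
  obtain ⟨B, hB⟩ : ∃ B : Matrix (Fin n) (Fin n) ℝ, (G y)⁻¹ = Bᵀ * B := by
    have := (hG.posDef y hy).inv.posSemidef
    open scoped MatrixOrder in
    obtain ⟨B, hB⟩ := CStarAlgebra.nonneg_iff_eq_star_mul_self.1 this.nonneg
    exact ⟨B, by rw [hB, star_eq_conjTranspose, conjTranspose_eq_transpose_of_trivial]⟩
  have hd : IsUnit B.det := by
    have h1 : (G y * (Bᵀ * B)).det = 1 := by rw [← hB, hG.mul_inv hy, det_one]
    rw [det_mul, det_mul] at h1
    refine isUnit_iff_ne_zero.2 fun h => ?_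
    simp [h] at h1
  have e : ricSq G y = (B * ric G y * Bᵀ * (B * ric G y * Bᵀ)ᵀ).trace := by
    simp only [ricSq, ricUp, transpose_mul, transpose_transpose, hG.ric_transpose hy, hB]
    rw [← Matrix.mul_assoc, ← Matrix.mul_assoc, Matrix.trace_mul_comm]
    simp only [Matrix.mul_assoc]
  have e2 : ∀ X : Matrix (Fin n) (Fin n) ℝ, (X * Xᵀ).trace = ∑ i, ∑ j, X i j ^ 2 := by
    intro X
    simp only [trace, diag_apply, Matrix.mul_apply, transpose_apply, pow_two]
  rw [e, e2]
  refine ⟨by positivity, fun h => ?_⟩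
  have hX : B * ric G y * Bᵀ = 0 := by
    ext i j
    have h1 := (Finset.sum_eq_zero_iff_of_nonneg fun i _ => by positivity).1 h i (Finset.mem_univ i)
    have h2 := (Finset.sum_eq_zero_iff_of_nonneg fun i _ => by positivity).1 h1 j
      (Finset.mem_univ j)
    simpa using h2
  have h3 := congrArg (fun X => B⁻¹ * X * (Bᵀ)⁻¹) hX
  simp only [Matrix.mul_zero, Matrix.zero_mul] at h3
  rwa [← Matrix.mul_assoc, ← Matrix.mul_assoc, nonsing_inv_mul _ hd, Matrix.one_mul,
    Matrix.mul_assoc, mul_nonsing_inv _ (by rwa [det_transpose]), Matrix.mul_one] at h3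

end PseudoRicciSymmetric

/-! ### Behaviour of connection and curvature under pullback. -/

section CoordinateChange

open Matrix

variable {U V : Set (Coord n)} {y : Coord n} {G H : Coord n → Matrix (Fin n) (Fin n) ℝ}
  {φ : Coord n → Coord n}

/-- The Jacobian matrix of a map `ℝⁿ → ℝⁿ`. -/
noncomputable def jac (φ : Coord n → Coord n) (y : Coord n) : Matrix (Fin n) (Fin n) ℝ :=
  Matrix.of fun a i => pd i (fun z => φ z a) y

/-- The algebra behind uniqueness of the Levi-Civita connection, applied to a difference of two
torsion-free metric connections. -/
lemma eq_zero_of_symm_of_skew {g : Matrix (Fin n) (Fin n) ℝ} (hg : gᵀ = g) (hdet : IsUnit g.det)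
    {D : Fin n → Matrix (Fin n) (Fin n) ℝ} (hsymm : ∀ i j k, D i k j = D j k i)
    (hskew : ∀ i, (D i)ᵀ * g + g * D i = 0) (i : Fin n) : D i = 0 := by
  have h1 : ∀ i a b, (g * D i) a b = -(g * D i) b a := by
    intro i a b
    have h := congrFun (congrFun (hskew i) a) b
    have e : (D i)ᵀ * g = (g * D i)ᵀ := by rw [transpose_mul, hg]
    rw [e, Matrix.add_apply, transpose_apply, Matrix.zero_apply] at h
    linarith
  have h2 : ∀ i a b, (g * D i) a b = (g * D b) a i := by
    intro i a b
    simp only [Matrix.mul_apply]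
    exact Finset.sum_congr rfl fun c _ => by rw [hsymm]
  -- Alternating the two symmetries three times each restores the entry with a minus sign.
  have h3 : g * D i = 0 := by
    ext a b
    have := h2 i a b
    have := h1 b a i
    have := h2 b i a
    have := h1 a i b
    have := h2 a b i
    have := h1 i a b
    simp only [Matrix.zero_apply]
    linarith
  have h4 := congrArg (fun X => g⁻¹ * X) h3
  simpa [← Matrix.mul_assoc, nonsing_inv_mul _ hdet] using h4

/-- `φ` is a smooth map from `V` to `U` pulling back the metric `G` to `H`. -/
structure IsLocalPullback (G H : Coord n → Matrix (Fin n) (Fin n) ℝ) (U V : Set (Coord n))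
    (φ : Coord n → Coord n) : Prop where
  left : IsLocalMetric G U
  right : IsLocalMetric H V
  smooth : ContDiffOn ℝ ∞ φ V
  mapsTo : Set.MapsTo φ V U
  eq : ∀ y ∈ V, H y = (jac φ y)ᵀ * G (φ y) * jac φ y

namespace IsLocalPullback

variable (h : IsLocalPullback G H U V φ)
include h

lemma isUnit_det_jac (hy : y ∈ V) : IsUnit (jac φ y).det := by
  have h1 := h.right.det_ne_zero hy
  rw [h.eq y hy, det_mul] at h1
  exact isUnit_iff_ne_zero.2 (right_ne_zero_of_mul h1)

lemma smooth_coord (a : Fin n) : ContDiffOn ℝ ∞ (fun z => φ z a) V :=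
  contDiffOn_euclidean.1 h.smooth a

lemma smooth_jac : SmoothMat (jac φ) V := fun a _ => contDiffOn_pd h.right.isOpen (h.smooth_coord a)

lemma smooth_comp {F : Coord n → Matrix (Fin n) (Fin n) ℝ} (hF : SmoothMat F U) :
    SmoothMat (fun z => F (φ z)) V := fun a b => (hF a b).comp h.smooth h.mapsTo

lemma mpd_comp_eq {F : Coord n → Matrix (Fin n) (Fin n) ℝ} (hF : SmoothMat F U) (hy : y ∈ V)
    (i : Fin n) : mpd i (fun z => F (φ z)) y = ∑ a, jac φ y a i • mpd a F (φ y) :=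
  mpd_comp (hF.diffMat h.left.isOpen (h.mapsTo hy))
    ((h.smooth.contDiffAt (h.right.isOpen.mem_nhds hy)).differentiableAt (by simp)) i

lemma pd_jac_symm (hy : y ∈ V) (a i j : Fin n) :
    pd i (fun z => jac φ z a j) y = pd j (fun z => jac φ z a i) y :=
  pd_comm h.right.isOpen (h.smooth_coord a) hy i j

omit h in
/-- The pullback of the connection form of `G` by `φ`. -/
noncomputable def _root_.RiemGeom.chrPullback (G : Coord n → Matrix (Fin n) (Fin n) ℝ)
    (φ : Coord n → Coord n) (i : Fin n) (y : Coord n) : Matrix (Fin n) (Fin n) ℝ :=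
  ∑ a, jac φ y a i • chr G a (φ y)

lemma smooth_chrPullback (i : Fin n) : SmoothMat (chrPullback G φ i) V :=
  SmoothMat.sum fun a _ => SmoothMat.smul (h.smooth_jac a i) (h.smooth_comp (h.left.smooth_chr a))

/-- The transformation law of Christoffel symbols. The pulled-back connection `(jac φ y)⁻¹ * X i` is
torsion-free and compatible with `H`, so uniqueness identifies it with `chr H i y`. -/
lemma jac_mul_chr (hy : y ∈ V) (i : Fin n) :
    jac φ y * chr H i y = mpd i (jac φ) y + chrPullback G φ i y * jac φ y := by
  have hV := h.right.isOpen
  have hJ := h.isUnit_det_jac hy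
  have hx := h.mapsTo hy
  set X : Fin n → Matrix (Fin n) (Fin n) ℝ :=
    fun i => mpd i (jac φ) y + chrPullback G φ i y * jac φ y with hX
  have hXs : ∀ i j c, X i c j = X j c i := by
    intro i j c
    have h1 : mpd i (jac φ) y c j = mpd j (jac φ) y c i := h.pd_jac_symm hy c i j
    have h2 : (chrPullback G φ i y * jac φ y) c j = (chrPullback G φ j y * jac φ y) c i := by
      simp only [chrPullback, Matrix.mul_apply, Matrix.sum_apply, Matrix.smul_apply, smul_eq_mul,
        Finset.sum_mul]
      rw [Finset.sum_comm]
      refine Finset.sum_congr rfl fun a _ => Finset.sum_congr rfl fun b _ => ?_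
      rw [h.left.chr_symm]
      ring
    simp only [hX, Matrix.add_apply, h1, h2]
  have hXm : ∀ i, mpd i H y = (X i)ᵀ * G (φ y) * jac φ y + (jac φ y)ᵀ * G (φ y) * X i := by
    intro i
    have s1 := h.smooth_jac.transpose
    have s2 := h.smooth_comp h.left.smooth
    have hB : mpd i (fun z => G (φ z)) y = (chrPullback G φ i y)ᵀ * G (φ y)
        + G (φ y) * chrPullback G φ i y := by
      rw [h.mpd_comp_eq h.left.smooth hy]
      simp only [h.left.mpd_eq hx, chrPullback, smul_add, Finset.sum_add_distrib, transpose_sum,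
        transpose_smul, Finset.sum_mul, Finset.mul_sum, Matrix.smul_mul, Matrix.mul_smul]
    rw [mpd_congr hV hy fun z hz => h.eq z hz, mpd_mul ((s1.mul s2).diffMat hV hy)
      (h.smooth_jac.diffMat hV hy), mpd_mul (s1.diffMat hV hy) (s2.diffMat hV hy), hB,
      mpd_transpose]
    simp only [hX, transpose_add, transpose_mul]
    noncomm_ring
  have key := eq_zero_of_symm_of_skew (h.right.transpose_eq y)
    (isUnit_iff_ne_zero.2 (h.right.det_ne_zero hy))
    (D := fun i => (jac φ y)⁻¹ * X i - chr H i y) ?_ ?_ i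
  · rw [sub_eq_zero] at key
    rw [← key, ← Matrix.mul_assoc, mul_nonsing_inv _ hJ, Matrix.one_mul]
  · intro i j k
    simp only [Matrix.sub_apply, Matrix.mul_apply, hXs i j, h.right.chr_symm i j]
  · intro i
    have h1 : (jac φ y) * ((jac φ y)⁻¹ * X i) = X i := by
      rw [← Matrix.mul_assoc, mul_nonsing_inv _ hJ, Matrix.one_mul]
    have h2 : ((jac φ y)⁻¹ * X i)ᵀ * H y = (X i)ᵀ * G (φ y) * jac φ y := by
      conv_rhs => rw [← h1, transpose_mul]
      rw [h.eq y hy]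
      simp only [Matrix.mul_assoc]
    have h3 : H y * ((jac φ y)⁻¹ * X i) = (jac φ y)ᵀ * G (φ y) * X i := by
      conv_rhs => rw [← h1]
      rw [h.eq y hy]
      simp only [Matrix.mul_assoc]
    have h4 := hXm i
    rw [h.right.mpd_eq hy, ← h2, ← h3, ← sub_eq_zero] at h4
    rw [← neg_eq_zero, ← h4]
    simp only [transpose_sub]
    noncomm_ring

/-- The exterior derivative commutes with pullback: second derivatives of `φ` cancel on
antisymmetrising. -/
lemma mpd_chrPullback (hy : y ∈ V) (i j : Fin n) :
    mpd i (chrPullback G φ j) y - mpd j (chrPullback G φ i) y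
      = ∑ a, ∑ b, (jac φ y a i * jac φ y b j) •
        (mpd a (chr G b) (φ y) - mpd b (chr G a) (φ y)) := by
  have hV := h.right.isOpen
  have e : ∀ i j, mpd i (chrPullback G φ j) y
      = ∑ a, pd i (fun z => jac φ z a j) y • chr G a (φ y)
        + ∑ a, ∑ b, (jac φ y a i * jac φ y b j) • mpd a (chr G b) (φ y) := by
    intro i j
    have s := fun a => (h.smooth_comp (h.left.smooth_chr a)).diffMat hV hy
    have hd : mpd i (chrPullback G φ j) y
        = ∑ a, mpd i (fun z => jac φ z a j • chr G a (φ z)) y :=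
      mpd_sum (fun a _ => (SmoothMat.smul (h.smooth_jac a j)
        (h.smooth_comp (h.left.smooth_chr a))).diffMat hV hy) i
    rw [hd, Finset.sum_comm (f := fun a b => (jac φ y a i * jac φ y b j) • mpd a (chr G b) (φ y)),
      ← Finset.sum_add_distrib]
    refine Finset.sum_congr rfl fun a _ => ?_
    rw [mpd_smul ((h.smooth_jac a j).differentiableAt_of_isOpen hV hy) (s a),
      h.mpd_comp_eq (h.left.smooth_chr a) hy, Finset.smul_sum]
    congr 1
    exact Finset.sum_congr rfl fun b _ => by rw [smul_smul, mul_comm]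
  rw [e, e]
  simp only [h.pd_jac_symm hy _ i j, smul_sub, Finset.sum_sub_distrib]
  rw [Finset.sum_comm (f := fun a b => (jac φ y a j * jac φ y b i) • mpd a (chr G b) (φ y))]
  simp only [mul_comm (jac φ y _ j)]
  abel

/-- Obtained by differentiating `jac_mul_chr` and antisymmetrising, which removes the second
derivatives of the Jacobian. -/
lemma curv_pullback (hy : y ∈ V) (i j : Fin n) :
    jac φ y * curv H i j y
      = (∑ a, ∑ b, (jac φ y a i * jac φ y b j) • curv G a b (φ y)) * jac φ y := by
  have hV := h.right.isOpen
  have hd : ∀ i j, mpd i (jac φ) y * chr H j y + jac φ y * mpd i (chr H j) y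
      = mpd i (mpd j (jac φ)) y + (mpd i (chrPullback G φ j) y * jac φ y
        + chrPullback G φ j y * mpd i (jac φ) y) := by
    intro i j
    have sJ := h.smooth_jac.diffMat hV hy
    rw [← mpd_mul sJ ((h.right.smooth_chr j).diffMat hV hy),
      ← mpd_mul ((h.smooth_chrPullback j).diffMat hV hy) sJ,
      ← mpd_add ((h.smooth_jac.mpd hV j).diffMat hV hy)
        (((h.smooth_chrPullback j).mul h.smooth_jac).diffMat hV hy)]
    exact mpd_congr hV hy (fun z hz => h.jac_mul_chr hz j) i
  have hB : ∑ a, ∑ b, (jac φ y a i * jac φ y b j) • curv G a b (φ y)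
      = mpd i (chrPullback G φ j) y - mpd j (chrPullback G φ i) y
        + (chrPullback G φ i y * chrPullback G φ j y
          - chrPullback G φ j y * chrPullback G φ i y) := by
    rw [h.mpd_chrPullback hy]
    simp only [curv, chrPullback, smul_add, smul_sub, Finset.sum_add_distrib,
      Finset.sum_sub_distrib, Finset.sum_mul, Finset.mul_sum, Matrix.smul_mul, Matrix.mul_smul,
      smul_smul]
    congr 2
    rw [Finset.sum_comm]
    refine Finset.sum_congr rfl fun a _ => Finset.sum_congr rfl fun b _ => ?_
    rw [mul_comm]
  have e1 := hd i j
  have e2 := hd j i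
  rw [mpd_comm hV h.smooth_jac hy j i] at e2
  have c : ∀ i j, jac φ y * (chr H i y * chr H j y) = mpd i (jac φ) y * chr H j y
      + chrPullback G φ i y * (mpd j (jac φ) y + chrPullback G φ j y * jac φ y) := by
    intro i j
    rw [← Matrix.mul_assoc, h.jac_mul_chr hy, Matrix.add_mul, Matrix.mul_assoc, h.jac_mul_chr hy]
  rw [hB, curv, Matrix.mul_add, Matrix.mul_sub, Matrix.mul_sub, c, c,
    eq_sub_of_add_eq' e1, eq_sub_of_add_eq' e2]
  noncomm_ring

lemma ric_pullback (hy : y ∈ V) : ric H y = (jac φ y)ᵀ * ric G (φ y) * jac φ y := by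
  have hJ := h.isUnit_det_jac hy
  have hc : ∀ i j, curv H i j y = (jac φ y)⁻¹ *
      ∑ a, ∑ b, (jac φ y a i * jac φ y b j) • (curv G a b (φ y) * jac φ y) := by
    intro i j
    have := congrArg (fun X => (jac φ y)⁻¹ * X) (h.curv_pullback hy i j)
    simp only [← Matrix.mul_assoc, nonsing_inv_mul _ hJ, Matrix.one_mul] at this
    rw [this, Matrix.mul_assoc]
    simp only [Finset.sum_mul, Matrix.smul_mul]
  have hδ : ∀ a c, ∑ i, jac φ y a i * (jac φ y)⁻¹ i c = if a = c then 1 else 0 := by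
    intro a c
    rw [← Matrix.mul_apply, mul_nonsing_inv _ hJ, Matrix.one_apply]
  ext j k
  have e : ∀ i, curv H i j y i k = ∑ c, ∑ a, ∑ b, (jac φ y a i * (jac φ y)⁻¹ i c) *
      (jac φ y b j * (curv G a b (φ y) * jac φ y) c k) := by
    intro i
    rw [hc, Matrix.mul_apply]
    simp only [Matrix.sum_apply, Matrix.smul_apply, smul_eq_mul, Finset.mul_sum]
    exact Finset.sum_congr rfl fun c _ => Finset.sum_congr rfl fun a _ =>
      Finset.sum_congr rfl fun b _ => by ring
  have e2 : ric H y j k = ∑ c, ∑ a, (∑ i, jac φ y a i * (jac φ y)⁻¹ i c) *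
      ∑ b, jac φ y b j * (curv G a b (φ y) * jac φ y) c k := by
    simp only [ric, Matrix.of_apply, e]
    rw [Finset.sum_comm]
    refine Finset.sum_congr rfl fun c _ => ?_
    rw [Finset.sum_comm]
    refine Finset.sum_congr rfl fun a _ => ?_
    rw [Finset.sum_mul]
    exact Finset.sum_congr rfl fun i _ => by rw [Finset.mul_sum]
  rw [e2]
  simp only [hδ, ite_mul, one_mul, zero_mul, Finset.sum_ite_eq', Finset.mem_univ, if_true]
  rw [Matrix.mul_assoc, Matrix.mul_apply, Finset.sum_comm]
  refine Finset.sum_congr rfl fun b _ => ?_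
  rw [← Finset.mul_sum, transpose_apply]
  congr 1
  simp only [Matrix.mul_apply, ric, Matrix.of_apply, Finset.sum_mul]
  exact Finset.sum_comm

/-- The Ricci endomorphism changes by conjugation, so traces of its powers are invariant. -/
lemma ricUp_pullback (hy : y ∈ V) :
    ricUp H y = (jac φ y)ᵀ * ricUp G (φ y) * ((jac φ y)ᵀ)⁻¹ := by
  have hJ := h.isUnit_det_jac hy
  rw [ricUp, h.ric_pullback hy, h.eq y hy, Matrix.mul_inv_rev, Matrix.mul_inv_rev, ricUp]
  simp only [Matrix.mul_assoc]
  rw [← Matrix.mul_assoc (jac φ y) (jac φ y)⁻¹, mul_nonsing_inv _ hJ, Matrix.one_mul]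

lemma scal_pullback (hy : y ∈ V) : scal H y = scal G (φ y) := by
  have hJ : IsUnit ((jac φ y)ᵀ).det := by
    rw [det_transpose]
    exact h.isUnit_det_jac hy
  rw [scal, h.ricUp_pullback hy, trace_mul_comm, ← Matrix.mul_assoc, nonsing_inv_mul _ hJ,
    Matrix.one_mul, scal]

lemma ricSq_pullback (hy : y ∈ V) : ricSq H y = ricSq G (φ y) := by
  have hJ : IsUnit ((jac φ y)ᵀ).det := by
    rw [det_transpose]
    exact h.isUnit_det_jac hy
  have e : ricUp H y * ricUp H y
      = (jac φ y)ᵀ * (ricUp G (φ y) * ricUp G (φ y)) * ((jac φ y)ᵀ)⁻¹ := by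
    rw [h.ricUp_pullback hy]
    simp only [Matrix.mul_assoc]
    rw [← Matrix.mul_assoc ((jac φ y)ᵀ)⁻¹ (jac φ y)ᵀ, nonsing_inv_mul _ hJ, Matrix.one_mul]
  rw [ricSq, e, trace_mul_comm, ← Matrix.mul_assoc, nonsing_inv_mul _ hJ, Matrix.one_mul, ricSq]

end IsLocalPullback

end CoordinateChange

/-! ### From the manifold to its charts. -/

section Charts

variable {M : Type*} [TopologicalSpace M] [ChartedSpace (EuclideanSpace ℝ (Fin n)) M]
  {e e' : Chart n M} {y : Coord n}

lemma mdifferentiable_of_mem_smoothCharts (he : e ∈ smoothCharts n M) :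
    e.MDifferentiable (𝓡 n) (𝓡 n) :=
  ⟨(contMDiffOn_of_mem_maximalAtlas he).mdifferentiableOn (by simp),
    (contMDiffOn_symm_of_mem_maximalAtlas he).mdifferentiableOn (by simp)⟩

lemma mfderiv_symm_eq_sum (e : Chart n M) (y v : Coord n) :
    mfderiv (𝓡 n) (𝓡 n) e.symm y v = ∑ i, v i • coordVec e y i := by
  have hv : v = ∑ a, v a • EuclideanSpace.single a (1 : ℝ) := by
    ext b
    simp [Pi.single_apply]
  conv_lhs => rw [hv]
  exact (map_sum (mfderiv (𝓡 n) (𝓡 n) e.symm y) _ _).trans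
    (Finset.sum_congr rfl fun a _ => map_smul (mfderiv (𝓡 n) (𝓡 n) e.symm y) _ _)

lemma eventuallyEq_comp_chartAt (f : M → ℝ) (p : M) : f =ᶠ[nhds p]
    (fun z => f ((chartAt (EuclideanSpace ℝ (Fin n)) p).symm z)) ∘
      chartAt (EuclideanSpace ℝ (Fin n)) p :=
  Filter.eventuallyEq_of_mem
    ((chartAt (EuclideanSpace ℝ (Fin n)) p).open_source.mem_nhds (mem_chart_source _ p))
    fun q hq => by
      simp only [Function.comp, (chartAt (EuclideanSpace ℝ (Fin n)) p).left_inv hq]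

variable [IsManifold (𝓡 n) ∞ M]

lemma ricci_eq (g : Metric n M) (e : Chart n M) (j k : Fin n) (y : Coord n) :
    ricci g e j k y = ric (gLow g e) y j k := by
  simp only [ricci, ric, Matrix.of_apply, riemann, curv, Matrix.add_apply, Matrix.sub_apply,
    Matrix.mul_apply, Finset.sum_sub_distrib]
  rfl

lemma covRicci_eq (g : Metric n M) (e : Chart n M) (i j l : Fin n) (y : Coord n) :
    covRicci g e i j l y = covRic (gLow g e) l y i j := by
  have h : ricci g e i j = fun z => ric (gLow g e) z i j := funext fun z => ricci_eq g e i j z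
  simp only [covRicci, covRic, Matrix.sub_apply, Matrix.mul_apply, Finset.sum_add_distrib, h,
    ricci_eq, sub_add_eq_sub_sub]
  congr 1
  exact Finset.sum_congr rfl fun m _ => mul_comm _ _

lemma chartAt_mem_smoothCharts (p : M) :
    (chartAt (EuclideanSpace ℝ (Fin n)) p : Chart n M) ∈ smoothCharts n M :=
  IsManifold.chart_mem_maximalAtlas p

lemma contMDiffOn_coordVec (he : e ∈ smoothCharts n M) (i : Fin n) :
    ContMDiffOn (𝓡 n) (𝓡 n).tangent ∞
      (fun y => (⟨e.symm y, coordVec e y i⟩ : TangentBundle (𝓡 n) M)) e.target := by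
  have h1 := (contMDiffOn_symm_of_mem_maximalAtlas he).contMDiffOn_tangentMapWithin (m := ∞)
    (by simp) e.open_target.uniqueMDiffOn
  have h2 : ContMDiffOn (𝓡 n) (𝓡 n).tangent ∞
      (fun y : Coord n => (⟨y, EuclideanSpace.single i (1 : ℝ)⟩ : TangentBundle (𝓡 n) (Coord n)))
      e.target :=
    contMDiffOn_vectorSpace_iff_contDiffOn.2 contDiffOn_const
  refine (h1.comp h2 fun y hy => hy).congr fun y hy => ?_
  simp only [Function.comp, tangentMapWithin, coordVec]
  rw [mfderivWithin_of_isOpen e.open_target hy]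

lemma smoothMat_gLow (g : Metric n M) (he : e ∈ smoothCharts n M) :
    SmoothMat (gLow g e) e.target := by
  intro i j
  rw [← contMDiffOn_iff_contDiffOn]
  intro y hy
  have h := ContMDiffWithinAt.clm_bundle_apply₂ (F₁ := Coord n) (F₂ := Coord n) (F₃ := ℝ)
    (E₁ := fun p : M => TangentSpace (𝓡 n) p) (E₂ := fun p : M => TangentSpace (𝓡 n) p)
    (E₃ := Bundle.Trivial M ℝ) (b := e.symm) (ψ := fun y => g.inner (e.symm y))
    (v := fun y => coordVec e y i) (w := fun y => coordVec e y j)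
    (g.contMDiff.contMDiffAt.comp_contMDiffWithinAt y
      (contMDiffOn_symm_of_mem_maximalAtlas he y hy))
    (contMDiffOn_coordVec he i y hy) (contMDiffOn_coordVec he j y hy)
  simp only [Bundle.contMDiffWithinAt_totalSpace] at h
  exact h.2

lemma contDiffOn_formCoeff (α : OneForm n M) (he : e ∈ smoothCharts n M) (i : Fin n) :
    ContDiffOn ℝ ∞ (fun y => formCoeff α e y i) e.target := by
  rw [← contMDiffOn_iff_contDiffOn]
  intro y hy
  have h := ContMDiffWithinAt.clm_bundle_apply (F₁ := Coord n) (F₂ := ℝ)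
    (E₁ := fun p : M => TangentSpace (𝓡 n) p)
    (E₂ := Bundle.Trivial M ℝ) (b := e.symm) (ϕ := fun y => α (e.symm y))
    (v := fun y => coordVec e y i)
    (α.contMDiff.contMDiffAt.comp_contMDiffWithinAt y
      (contMDiffOn_symm_of_mem_maximalAtlas he y hy))
    (contMDiffOn_coordVec he i y hy)
  simp only [Bundle.contMDiffWithinAt_totalSpace] at h
  exact h.2

lemma isLocalMetric_gLow (g : Metric n M) (he : e ∈ smoothCharts n M) :
    IsLocalMetric (gLow g e) e.target where
  isOpen := e.open_target
  smooth := smoothMat_gLow g he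
  symm _ _ _ := g.symm _ _ _
  posDef y hy := by
    refine Matrix.PosDef.of_dotProduct_mulVec_pos
      (Matrix.IsHermitian.ext fun i j => g.symm _ _ _) fun x hx => ?_
    set v : TangentSpace (𝓡 n) (e.symm y) := ∑ i, x i • coordVec e y i with hv
    -- The coordinate vectors are independent, because the derivative of `e` inverts that of
    -- `e.symm`.
    have hv0 : v ≠ 0 := by
      intro h0
      have h1 := mfderiv_symm_eq_sum e y (WithLp.toLp 2 x)
      have h2 := congrArg (fun L => L (WithLp.toLp 2 x))
        ((mdifferentiable_of_mem_smoothCharts he).comp_symm_deriv hy)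
      have h3 : mfderiv (𝓡 n) (𝓡 n) e.symm y (WithLp.toLp 2 x) = 0 := h1.trans h0
      have h4 : (0 : Coord n) = WithLp.toLp 2 x := by
        refine Eq.trans ?_ h2
        exact ((congrArg (mfderiv (𝓡 n) (𝓡 n) e (e.symm y)) h3).trans (map_zero _)).symm
      apply hx
      simpa using (congrArg WithLp.ofLp h4).symm
    have e1 : star x ⬝ᵥ (gLow g e y).mulVec x = g.inner (e.symm y) v v := by
      simp only [hv, map_sum, map_smul, sum_apply,
        smul_apply, smul_eq_mul, dotProduct, Matrix.mulVec, gLow,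
        Matrix.of_apply, Finset.mul_sum, star_trivial]
      conv_lhs => rw [Finset.sum_comm]
      refine Finset.sum_congr rfl fun i _ => Finset.sum_congr rfl fun j _ => ?_
      ring
    rw [e1]
    exact g.pos _ v hv0

/-- Moves the base point while keeping the vectors, every tangent space being `Coord n` by
definition. -/
lemma Metric.inner_congr (g : Metric n M) {p q : M} (h : p = q) (u v : Coord n) :
    g.inner p u v = g.inner q u v := by
  subst h
  rfl

lemma isLocalPullback_gLow (g : Metric n M) (he : e ∈ smoothCharts n M)
    (he' : e' ∈ smoothCharts n M) :
    IsLocalPullback (gLow g e) (gLow g e') e.target (e'.target ∩ e'.symm ⁻¹' e.source)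
      (fun y => e (e'.symm y)) := by
  have hV : IsOpen (e'.target ∩ e'.symm ⁻¹' e.source) := e'.isOpen_inter_preimage_symm e.open_source
  have hR := isLocalMetric_gLow g he'
  have hφ : ContDiffOn ℝ ∞ (fun y => e (e'.symm y)) (e'.target ∩ e'.symm ⁻¹' e.source) := by
    rw [← contMDiffOn_iff_contDiffOn]
    exact (contMDiffOn_of_mem_maximalAtlas he).comp
      ((contMDiffOn_symm_of_mem_maximalAtlas he').mono Set.inter_subset_left) fun y hy => hy.2
  refine ⟨isLocalMetric_gLow g he, ⟨hV, fun a b => (hR.smooth a b).mono Set.inter_subset_left,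
    hR.symm, fun y hy => hR.posDef y hy.1⟩, hφ, fun y hy => e.map_source hy.2, fun y hy => ?_⟩
  have hp : e.symm (e (e'.symm y)) = e'.symm y := e.left_inv hy.2
  have hφd : DifferentiableAt ℝ (fun y => e (e'.symm y)) y :=
    (hφ.contDiffAt (hV.mem_nhds hy)).differentiableAt (by simp)
  have hvec : ∀ i, (coordVec e' y i : Coord n) = ∑ a, jac (fun y => e (e'.symm y)) y a i •
      (coordVec e (e (e'.symm y)) a : Coord n) := by
    intro i
    have h1 : mfderiv (𝓡 n) (𝓡 n) (e.symm ∘ fun y => e (e'.symm y)) y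
        = (mfderiv (𝓡 n) (𝓡 n) e.symm (e (e'.symm y))).comp
          (mfderiv (𝓡 n) (𝓡 n) (fun y => e (e'.symm y)) y) :=
      mfderiv_comp y ((mdifferentiable_of_mem_smoothCharts he).mdifferentiableAt_symm
        (e.map_source hy.2)) hφd.mdifferentiableAt
    have h2 : (e.symm ∘ fun y => e (e'.symm y)) =ᶠ[nhds y] e'.symm :=
      Filter.mem_of_superset (hV.mem_nhds hy) fun z hz => e.left_inv hz.2
    have h3 := congrArg (fun L : Coord n →L[ℝ] Coord n => L (EuclideanSpace.single i 1))
      (h2.mfderiv_eq.symm.trans h1)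
    have h4 : ∀ a, jac (fun y => e (e'.symm y)) y a i
        = (fderiv ℝ (fun y => e (e'.symm y)) y (EuclideanSpace.single i 1)) a := by
      intro a
      have := (((EuclideanSpace.proj (𝕜 := ℝ) a).hasFDerivAt
        (x := e (e'.symm y))).comp y hφd.hasFDerivAt).fderiv
      exact congrArg (fun L : Coord n →L[ℝ] ℝ => L (EuclideanSpace.single i 1)) this
    simp only [h4]
    refine h3.trans ?_
    rw [mfderiv_eq_fderiv]
    exact mfderiv_symm_eq_sum e _ _
  ext i j
  have h5 : gLow g e' y i j = g.inner (e.symm (e (e'.symm y)))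
      (∑ a, jac (fun y => e (e'.symm y)) y a i • coordVec e (e (e'.symm y)) a)
      (∑ a, jac (fun y => e (e'.symm y)) y a j • coordVec e (e (e'.symm y)) a) := by
    refine Eq.trans ?_ (g.inner_congr hp.symm _ _)
    exact congrArg₂ (fun u v : Coord n => g.inner (e'.symm y) u v) (hvec i) (hvec j)
  rw [h5]
  simp only [map_sum, map_smul, sum_apply, smul_apply,
    smul_eq_mul, Matrix.mul_apply, Matrix.transpose_apply, gLow, Matrix.of_apply, Finset.sum_mul,
    Finset.mul_sum]
  refine Finset.sum_congr rfl fun a _ => Finset.sum_congr rfl fun b _ => ?_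
  ring

/-- The chart in `scalarCurv` varies with the point; invariance under transition maps allows one
fixed chart `e` near `p`. -/
lemma scalarCurv_eq (g : Metric n M) (he : e ∈ smoothCharts n M) {p : M} (hp : p ∈ e.source) :
    scalarCurv g p = scal (gLow g e) (e p) := by
  set c : Chart n M := chartAt (EuclideanSpace ℝ (Fin n)) p with hc
  have hpc : p ∈ c.source := mem_chart_source _ p
  have h1 : scalarCurv g p = scal (gLow g c) (c p) := by
    simp only [scalarCurv, scal, ricUp, Matrix.trace, Matrix.diag_apply, Matrix.mul_apply,
      ricci_eq, ← hc]
    rw [Finset.sum_comm]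
    exact Finset.sum_congr rfl fun j _ => Finset.sum_congr rfl fun i _ => by
      rw [(isLocalMetric_gLow g (chartAt_mem_smoothCharts p)).ric_symm (c.map_source hpc) i j,
        mul_comm]
      rfl
  have h2 := (isLocalPullback_gLow g he (chartAt_mem_smoothCharts p)).scal_pullback (y := c p)
    ⟨c.map_source hpc, by simpa [← hc, c.left_inv hpc] using hp⟩
  rw [h1, h2, ← hc, c.left_inv hpc]

lemma ricciNormSq_eq (g : Metric n M) (he : e ∈ smoothCharts n M) {p : M} (hp : p ∈ e.source) :
    ricciNormSq g p = ricSq (gLow g e) (e p) := by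
  set c : Chart n M := chartAt (EuclideanSpace ℝ (Fin n)) p with hc
  have hpc : p ∈ c.source := mem_chart_source _ p
  have h1 : ricciNormSq g p = ricSq (gLow g c) (c p) := by
    have hm := isLocalMetric_gLow g (chartAt_mem_smoothCharts p)
    rw [← hc] at hm
    have hs := fun a b => hm.ric_symm (c.map_source hpc) a b
    have hu : ∀ a b, (gLow g c (c p))⁻¹ a b = (gLow g c (c p))⁻¹ b a := fun a b =>
      congrFun (congrFun (hm.inv_transpose (c p)) b) a
    simp only [ricciNormSq, ricSq, ricUp, Matrix.trace, Matrix.diag_apply, Matrix.mul_apply,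
      ricci_eq, ← hc, gUp, Finset.sum_mul_sum]
    refine Finset.sum_congr rfl fun i _ => ?_
    rw [Finset.sum_congr rfl fun j _ => Finset.sum_comm, Finset.sum_comm]
    refine Finset.sum_congr rfl fun b _ => Finset.sum_congr rfl fun j _ =>
      Finset.sum_congr rfl fun a _ => ?_
    rw [hs b a, hu a i]
    ring
  have h2 := (isLocalPullback_gLow g he (chartAt_mem_smoothCharts p)).ricSq_pullback (y := c p)
    ⟨c.map_source hpc, by simpa [← hc, c.left_inv hpc] using hp⟩
  rw [h1, h2, ← hc, c.left_inv hpc]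

end Charts

/-! ### The equation df = c f α. -/

variable {M : Type*} [TopologicalSpace M] [ChartedSpace (EuclideanSpace ℝ (Fin n)) M]
  [IsManifold (𝓡 n) ∞ M] {e : Chart n M} {g : Metric n M} {α : OneForm n M} {c : ℝ} {f h : M → ℝ}

/-- `f` is a differentiable solution of `df = c f α`, in all smooth charts. -/
def IsExpSolution (α : OneForm n M) (c : ℝ) (f : M → ℝ) : Prop :=
  ∀ e ∈ smoothCharts n M, ∀ y ∈ e.target, DifferentiableAt ℝ (fun z => f (e.symm z)) y ∧
    ∀ l, pd l (fun z => f (e.symm z)) y = c * formCoeff α e y l * f (e.symm y)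

namespace IsExpSolution

lemma sub (hf : IsExpSolution α c f) (hh : IsExpSolution α c h) :
    IsExpSolution α c (fun p => f p - h p) := by
  intro e he y hy
  obtain ⟨h1, h2⟩ := hf e he y hy
  obtain ⟨h3, h4⟩ := hh e he y hy
  refine ⟨h1.sub h3, fun l => ?_⟩
  rw [pd_sub h1 h3, h2, h4]
  ring

lemma const_mul (k : ℝ) (hf : IsExpSolution α c f) : IsExpSolution α c (fun p => k * f p) := by
  intro e he y hy
  obtain ⟨h1, h2⟩ := hf e he y hy
  refine ⟨h1.const_mul k, fun l => ?_⟩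
  rw [pd_mul (differentiableAt_const k) h1, pd_const, h2]
  ring

lemma sq (hf : IsExpSolution α c f) : IsExpSolution α (2 * c) (fun p => f p ^ 2) := by
  intro e he y hy
  obtain ⟨h1, h2⟩ := hf e he y hy
  refine ⟨h1.pow 2, fun l => ?_⟩
  simp only [pow_two]
  rw [pd_mul h1 h1, h2]
  ring

lemma mdifferentiable (hf : IsExpSolution α c f) : MDifferentiable (𝓡 n) 𝓘(ℝ, ℝ) f := by
  intro p
  have h1 := (hf _ (chartAt_mem_smoothCharts p) _ (mem_chart_target _ p)).1
  exact (h1.mdifferentiableAt.comp p ((mdifferentiable_of_mem_smoothCharts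
    (chartAt_mem_smoothCharts p)).mdifferentiableAt
      (mem_chart_source _ p))).congr_of_eventuallyEq (eventuallyEq_comp_chartAt f p)

lemma differential_eq (hf : IsExpSolution α c f) (p : M) (v : TangentSpace (𝓡 n) p) :
    differential f p v = c * α p v * f p := by
  obtain ⟨h1, h2⟩ := hf _ (chartAt_mem_smoothCharts p) _ (mem_chart_target _ p)
  have hm := mdifferentiable_of_mem_smoothCharts (chartAt_mem_smoothCharts (n := n) p)
  have hs := mem_chart_source (EuclideanSpace ℝ (Fin n)) p
  set e : Chart n M := chartAt (EuclideanSpace ℝ (Fin n)) p with he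
  have hp : e.symm (e p) = p := e.left_inv hs
  set w : Coord n := mfderiv (𝓡 n) (𝓡 n) e p v with hw
  have hd : differential f p v = fderiv ℝ (fun z => f (e.symm z)) (e p) w := by
    have h3 := mfderiv_comp p (g := fun z => f (e.symm z)) (f := e) (I'' := 𝓘(ℝ, ℝ))
      h1.mdifferentiableAt (hm.mdifferentiableAt hs)
    rw [mfderiv_eq_fderiv] at h3
    exact congrArg (fun L : Coord n →L[ℝ] ℝ => L v)
      ((eventuallyEq_comp_chartAt f p).mfderiv_eq.trans h3)
  have hv : ∀ q, q = p → ∀ u : Coord n, α q u = α p u := by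
    rintro q rfl u
    rfl
  have hα : α p v = ∑ l, w l * formCoeff α e (e p) l := by
    have h4 : mfderiv (𝓡 n) (𝓡 n) e.symm (e p) w = (v : Coord n) :=
      congrArg (fun L : Coord n →L[ℝ] Coord n => L v) (hm.symm_comp_deriv hs)
    have h5 := (mfderiv_symm_eq_sum e (e p) w).symm.trans h4
    have h6 : α (e.symm (e p)) (∑ i, w i • coordVec e (e p) i) = α p v :=
      (hv _ hp _).trans (congrArg (fun u : Coord n => α p u) h5)
    rw [← h6, map_sum]
    exact Finset.sum_congr rfl fun i _ => map_smul _ _ _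
  rw [hd, fderiv_eq_sum_pd, hα, Finset.mul_sum, Finset.sum_mul]
  refine Finset.sum_congr rfl fun l _ => ?_
  rw [h2, hp]
  ring

/-- On a segment issuing from `p` in a coordinate ball, `f` solves a linear ODE with bounded
coefficient and zero initial value; Grönwall's inequality makes it vanish. -/
lemma eventually_eq_zero (hf : IsExpSolution α c f) {p : M} (hp : f p = 0) :
    ∀ᶠ q in nhds p, f q = 0 := by
  have he := chartAt_mem_smoothCharts (n := n) p
  have hs := mem_chart_source (EuclideanSpace ℝ (Fin n)) p
  set e : Chart n M := chartAt (EuclideanSpace ℝ (Fin n)) p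
  obtain ⟨r, hr, hball⟩ := Metric.isOpen_iff.1 e.open_target (e p) (e.map_source hs)
  have hzero : ∀ y ∈ Metric.ball (e p) r, f (e.symm y) = 0 := by
    intro y hy
    set γ : ℝ → Coord n := fun t => e p + t • (y - e p) with hγ
    have hγd : ∀ t, HasDerivAt γ (y - e p) t := fun t => by
      have := ((hasDerivAt_id t).smul_const (y - e p)).const_add (e p)
      rwa [one_smul] at this
    have hγm : ∀ t ∈ Set.Icc (0 : ℝ) 1, γ t ∈ e.target := fun t ht =>
      hball ((convex_ball (e p) r).add_smul_sub_mem (Metric.mem_ball_self hr) hy ht)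
    set a : ℝ → ℝ := fun t => ∑ l, (y - e p) l * (c * formCoeff α e (γ t) l) with ha
    have hac : ContinuousOn a (Set.Icc 0 1) := by
      refine continuousOn_finsetSum _ fun l _ => continuousOn_const.mul (continuousOn_const.mul ?_)
      exact (contDiffOn_formCoeff α he l).continuousOn.comp
        (fun t _ => (hγd t).continuousAt.continuousWithinAt) hγm
    obtain ⟨K, hK⟩ := isCompact_Icc.exists_bound_of_continuousOn hac
    have hF : ∀ t ∈ Set.Icc (0 : ℝ) 1,
        HasDerivAt (fun t => f (e.symm (γ t))) (a t * f (e.symm (γ t))) t := by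
      intro t ht
      obtain ⟨h1, h2⟩ := hf e he (γ t) (hγm t ht)
      have h3 := h1.hasFDerivAt.comp_hasDerivAt t (hγd t)
      rw [fderiv_eq_sum_pd] at h3
      refine h3.congr_deriv ?_
      simp only [ha, Finset.sum_mul, h2]
      exact Finset.sum_congr rfl fun l _ => by ring
    have h0 := eq_zero_of_abs_deriv_le_mul_abs_self_of_eq_zero_right
      (f := fun t => f (e.symm (γ t))) (K := K) (a := 0) (b := 1)
      (fun t ht => (hF t ht).continuousAt.continuousWithinAt)
      (fun t ht => (hF t (Set.Ico_subset_Icc_self ht)).hasDerivWithinAt)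
      (by simp [hγ, e.left_inv hs, hp])
      (fun t ht => by
        rw [norm_mul]
        exact mul_le_mul_of_nonneg_right (hK t (Set.Ico_subset_Icc_self ht)) (norm_nonneg _))
      1 (by simp)
    simpa [hγ] using h0
  filter_upwards [e.open_source.mem_nhds hs,
    (e.continuousAt hs).preimage_mem_nhds (Metric.ball_mem_nhds _ hr)] with q hq hq2
  have := hzero (e q) hq2
  rwa [e.left_inv hq] at this

lemma eq_zero [PreconnectedSpace M] (hf : IsExpSolution α c f) {p : M} (hp : f p = 0) (q : M) :
    f q = 0 := by
  have ho : IsOpen {q | f q = 0} := isOpen_iff_eventually.2 fun _ hq => hf.eventually_eq_zero hq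
  have hc : IsClosed {q | f q = 0} := isClosed_eq hf.mdifferentiable.continuous continuous_const
  have := IsClopen.eq_univ ⟨hc, ho⟩ ⟨p, hp⟩
  exact Set.eq_univ_iff_forall.1 this q

lemma isMulDifferential_log (hf : IsExpSolution α c f) (hc : c ≠ 0) (h0 : ∀ p, f p ≠ 0) :
    IsMulDifferential α (1 / c) (fun p => Real.log (f p)) := by
  have hl : ∀ p, HasMFDerivAt (𝓡 n) 𝓘(ℝ, ℝ) (fun p => Real.log (f p)) p
      ((ContinuousLinearMap.smulRight (1 : ℝ →L[ℝ] ℝ) (f p)⁻¹).comp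
        (mfderiv (𝓡 n) 𝓘(ℝ, ℝ) f p)) := fun p =>
    (Real.hasDerivAt_log (h0 p)).hasFDerivAt.hasMFDerivAt.comp p (hf.mdifferentiable p).hasMFDerivAt
  refine ⟨fun p => (hl p).mdifferentiableAt, fun p v => ?_⟩
  have h1 : differential (fun p => Real.log (f p)) p v = differential f p v * (f p)⁻¹ :=
    congrArg (fun L : Coord n →L[ℝ] ℝ => L v) (hl p).mfderiv
  rw [h1, hf.differential_eq]
  have := h0 p
  field_simp

end IsExpSolution

lemma isExpSolution_of_chart {F : Chart n M → Coord n → ℝ}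
    (hf : ∀ e ∈ smoothCharts n M, ∀ p ∈ e.source, f p = F e (e p))
    (hd : ∀ e ∈ smoothCharts n M, ContDiffOn ℝ ∞ (F e) e.target)
    (hF : ∀ e ∈ smoothCharts n M, ∀ y ∈ e.target, ∀ l,
      pd l (F e) y = c * formCoeff α e y l * F e y) : IsExpSolution α c f := by
  intro e he y hy
  have h1 : Set.EqOn (fun z => f (e.symm z)) (F e) e.target := fun z hz => by
    simp only [hf e he _ (e.map_target hz), e.right_inv hz]
  have h2 := (hd e he).differentiableAt_of_isOpen e.open_target hy
  refine ⟨h2.congr_of_eventuallyEq (h1.eventuallyEq_of_mem (e.open_target.mem_nhds hy)),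
    fun l => ?_⟩
  rw [pd_congr e.open_target hy h1, hF e he y hy]
  exact congrArg _ (h1 hy).symm

/-! ### Global consequences of pseudo Ricci symmetry. -/

lemma IsPRS.local_eqns (hPRS : IsPRS g α) (he : e ∈ smoothCharts n M) {y : Coord n}
    (hy : y ∈ e.target) :
    (ricUp (gLow g e) y).mulVec (formCoeff α e y) = 0 ∧
      (∀ l, pd l (scal (gLow g e)) y = 2 * formCoeff α e y l * scal (gLow g e) y) ∧
      ∀ l, pd l (ricSq (gLow g e)) y = 4 * formCoeff α e y l * ricSq (gLow g e) y := by
  refine (isLocalMetric_gLow g he).pseudoRicciSymmetric_eqns hy fun i j l => ?_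
  simpa only [ricci_eq, covRicci_eq] using hPRS.eqn e he y hy i j l

lemma IsPRS.ricciAnnihilates (hPRS : IsPRS g α) : RicciAnnihilates g α := by
  intro e he y hy i
  refine Eq.trans ?_ (congrFun (hPRS.local_eqns he hy).1 i)
  simp only [Matrix.mulVec, dotProduct, ricUp, Matrix.mul_apply, Finset.sum_mul, ricci_eq]
  exact Finset.sum_comm

lemma IsPRS.isExpSolution_scalarCurv (hPRS : IsPRS g α) : IsExpSolution α 2 (scalarCurv g) :=
  isExpSolution_of_chart (F := fun e => scal (gLow g e)) (fun _ he _ hp => scalarCurv_eq g he hp)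
    (fun _ he => (isLocalMetric_gLow g he).smooth_ricUp.trace)
    fun _ he _ hy => (hPRS.local_eqns he hy).2.1

lemma IsPRS.isExpSolution_ricciNormSq (hPRS : IsPRS g α) : IsExpSolution α 4 (ricciNormSq g) :=
  isExpSolution_of_chart (F := fun e => ricSq (gLow g e)) (fun _ he _ hp => ricciNormSq_eq g he hp)
    (fun _ he => ((isLocalMetric_gLow g he).smooth_ricUp.mul
      (isLocalMetric_gLow g he).smooth_ricUp).trace)
    fun _ he _ hy => (hPRS.local_eqns he hy).2.2

lemma ricciNormSq_nonneg (g : Metric n M) (p : M) : 0 ≤ ricciNormSq g p := by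
  rw [ricciNormSq_eq g (chartAt_mem_smoothCharts p) (mem_chart_source _ p)]
  exact (ricSq_nonneg_and_ric_eq_zero (isLocalMetric_gLow g (chartAt_mem_smoothCharts p))
    (mem_chart_target _ p)).1

lemma RicciNonzero.exists_ricciNormSq_ne_zero (h : RicciNonzero g) : ∃ p, ricciNormSq g p ≠ 0 := by
  obtain ⟨e, he, y, hy, i, j, hij⟩ := h
  refine ⟨e.symm y, fun h0 => hij ?_⟩
  rw [ricciNormSq_eq g he (e.map_target hy), e.right_inv hy] at h0
  rw [ricci_eq, (ricSq_nonneg_and_ric_eq_zero (isLocalMetric_gLow g he) hy).2 h0]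
  rfl

end RiemGeom

theorem mainTheorem2 {n : ℕ} (hn : 3 ≤ n) {M : Type*} [TopologicalSpace M] [ConnectedSpace M]
    [ChartedSpace (EuclideanSpace ℝ (Fin n)) M] [IsManifold (𝓡 n) ∞ M]
    (g : RiemGeom.Metric n M) (α : RiemGeom.OneForm n M)
    (hRi : RiemGeom.RicciNonzero g) (hPRS : RiemGeom.IsPRS g α) :
    RiemGeom.RicciAnnihilates g α ∧
    (∀ p : M, 0 < RiemGeom.ricciNormSq g p) ∧
    RiemGeom.IsMulDifferential α (1 / 4) (fun p => Real.log (RiemGeom.ricciNormSq g p)) ∧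
    ((∃ p : M, RiemGeom.scalarCurv g p ≠ 0) →
      (∀ p : M, RiemGeom.scalarCurv g p ≠ 0) ∧
      RiemGeom.IsMulDifferential α (1 / 2) (fun p => Real.log |RiemGeom.scalarCurv g p|) ∧
      ∃ c : ℝ, ∀ p : M, RiemGeom.scalarCurv g p ^ 2 = c * RiemGeom.ricciNormSq g p) := by
  have hN := hPRS.isExpSolution_ricciNormSq
  have hS := hPRS.isExpSolution_scalarCurv
  obtain ⟨p₀, hp₀⟩ := hRi.exists_ricciNormSq_ne_zero
  have hN0 : ∀ p, RiemGeom.ricciNormSq g p ≠ 0 := fun p hp => hp₀ (hN.eq_zero hp p₀)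
  refine ⟨hPRS.ricciAnnihilates,
    fun p => lt_of_le_of_ne (RiemGeom.ricciNormSq_nonneg g p) (hN0 p).symm,
    hN.isMulDifferential_log (by norm_num) hN0, ?_⟩
  rintro ⟨q, hq⟩
  have hS0 : ∀ p, RiemGeom.scalarCurv g p ≠ 0 := fun p hp => hq (hS.eq_zero hp q)
  -- This constant makes sc² - c |Ri|² vanish at `p₀`.
  refine ⟨hS0, ?_, RiemGeom.scalarCurv g p₀ ^ 2 / RiemGeom.ricciNormSq g p₀, fun p => ?_⟩
  -- `Real.log` is even, so the absolute value can be dropped whatever the sign of sc.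
  · simp only [Real.log_abs]
    exact hS.isMulDifferential_log (by norm_num) hS0
  · have hS2 : RiemGeom.IsExpSolution α 4 (fun p => RiemGeom.scalarCurv g p ^ 2) := by
      have := hS.sq
      norm_num at this
      exact this
    have := (hS2.sub (hN.const_mul
      (RiemGeom.scalarCurv g p₀ ^ 2 / RiemGeom.ricciNormSq g p₀))).eq_zero (p := p₀)
      (by field_simp; ring) p
    exact sub_eq_zero.1 this
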